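/- **Setting.** Let $K\ge D\ge 1$, $L\ge 1$ be integers and $N=DL+1$. Let $\mathbb F_q$ be a finite field and let $m\ge 1$ be a multiple of $L$. Each of $N$ non-colluding servers stores the same $K$ messages $X_1,\dots,X_K$, which are independent and uniform on $\mathbb F_q^m$; each message is divided into $L$ subpackets of $m/L$ symbols. The demand $W$ is a uniformly random $D$-subset of $\{1,\dots,K\}$, independent of the messages. A linear protocol with subpacketization degree $L$ draws, given $W$ and independently of the messages, queries $Q_1,\dots,Q_N$; the answer $A_n$ of server $n$ is a list, determined by $Q_n$, of $\mathbb F_q$-linear combinations of the $KL$ message subpackets. The protocol is *private* if $\mathbb P(W=w\mid Q_n=\mathsf q)=\mathbb P(W=w)$ for every server $n$, every $w$ and every query $\mathsf q$ of positive probability, and *recoverable* if for every fixed demand $W$ one has $H(X_W\mid A_1,\dots,A_N,Q_1,\dots,Q_N)=0$. Its *rate* is $H(X_W)/\sum_{n=1}^N H(A_n\mid Q_n)$. The *capacity* is the supremum of the rates of all private and recoverable linear protocols with subpacketization degree $L$ (for the given $K,D,N,q,m$). Put $\beta_j=DL/\binom Dj$ for $1\le j\le D$. Let $M$ be the $D\times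 D$ matrix whose first row has all entries $1/\beta_1$, whose entry at (row $r$, column $r-1$) is $\beta_{r-1}/\beta_r$ for $2\le r\le D$, and whose other entries are $0$. Let $f^{\mathsf T}=\mathbf 1^{\mathsf T}M^{K-D}$, $g^{\mathsf T}=\mathbf 1^{\mathsf T}(I+M)^{K-D}$ and $$R=\frac{DL}{N-\max_{1\le j\le D} f_j/g_j}.$$ **The scheme.** Let $j^*$ maximize $f_j/g_j$. Define $P_{K-D,j^*}=1/g_{j^*}$, $P_{K-D,j}=0$ for $j\ne j^*$, and $(P_{i,1},\dots,P_{i,D})^{\mathsf T}=\binom{K-D}{i}M^{K-D-i}(P_{K-D,1},\dots,P_{K-D,D})^{\mathsf T}$ for $0\le i<K-D$. Given the demand $W=\{w_1<\dots<w_D\}$ with complement $\{u_1<\dots<u_{K-D}\}$, the user draws a pair $(i,j)$ with probability $P_{i,j}$; a uniformly random $h\in\mathbb F_q^{K-D}$ with exactly $i$ nonzero entries; a uniformly random $j$-subset $J$ of $\{1,\dots,D\}$; a uniformly random invertible $D\times D$ matrix over $\mathbb F_q$ with rows $g_1,\dots,g_D$ such that $g_1$ has support $J$ and the support of each further row is the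 circular shift by one position of the support of the preceding row; an independent uniformly random ordering $X_{k,1},\dots,X_{k,L}$ of the subpackets of each message; and a uniformly random assignment of the following $N$ linear combinations to the $N$ servers: $$Y_1=h\cdot[X_{u_1,1},\dots,X_{u_{K-D},1}]^{\mathsf T},\qquad Y_{(l-1)D+r+1}=Y_1+g_r\cdot[X_{w_1,l},\dots,X_{w_D,l}]^{\mathsf T}\quad(1\le l\le L,\ 1\le r\le D).$$ Each server receives as its query the coefficient vector (in $\mathbb F_q^{KL}$) of its linear combination, and its answer is this one linear combination. **Theorem.** 1. If $q\ge 3$, then the capacity is at least $R$. Moreover, for every maximizer $j^*$ the numbers $P_{i,j}$ ($0\le i\le K-D$, $1\le j\le D$) form a probability distribution, and the scheme is private, recoverable and has rate exactly $R$. 2. For every $q$, the capacity is at most $$\left(\frac{1-1/N^{\lfloor K/D\rfloor}}{1-1/N}+\left(\frac KD-\left\lfloor\frac KD\right\rfloor\right)\frac1{N^{\lfloor K/D\rfloor}}\right)^{-1}.$$ -/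

import Mathlib

open scoped ENNReal

universe u

noncomputable section

namespace MPIR

/-! Discrete entropy, in bits. A random variable is a function on a space carrying a `PMF`.
The values lie in `[0, ∞]`, so that no convergence convention is needed. -/

/-- The Shannon entropy `H(Y)`. -/
def entropy {Ω α : Type*} (p : PMF Ω) (Y : Ω → α) : ℝ≥0∞ :=
  ∑' y, ENNReal.ofReal (Real.negMulLog ((p.map Y) y).toReal / Real.log 2)

/-- The conditional probability `P(Y = y | Z = z)` (of interest only if `P(Z = z) ≠ 0`). -/
def condProb {Ω α β : Type*} (p : PMF Ω) (Y : Ω → α) (Z : Ω → β) (y : α) (z : β) : ℝ≥0∞ :=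
  (p.map fun ω => (Y ω, Z ω)) (y, z) / (p.map Z) z

/-- The conditional entropy `H(Y | Z) = ∑_z P(Z = z) H(Y | Z = z)`. -/
def condEntropy {Ω α β : Type*} (p : PMF Ω) (Y : Ω → α) (Z : Ω → β) : ℝ≥0∞ :=
  ∑' z, (p.map Z) z *
    ∑' y, ENNReal.ofReal (Real.negMulLog (condProb p Y Z y z).toReal / Real.log 2)

/-! The retrieval problem. -/

/-- A demand: a set of `D` of the `K` message indices. -/
abbrev Demand (K D : ℕ) : Type := {W : Finset (Fin K) // W.card = D}

lemma demand_nonempty {K D : ℕ} (h : D ≤ K) : Nonempty (Demand K D) := by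
  obtain ⟨W, -, hW⟩ := Finset.exists_subset_card_eq (s := (Finset.univ : Finset (Fin K)))
    (n := D) (by simpa using h)
  exact ⟨⟨W, hW⟩⟩

/-- The demand indices in increasing order. -/
def Demand.idx {K D : ℕ} (W : Demand K D) : Fin D ↪o Fin K := W.1.orderEmbOfFin W.2

/-- The interference (not demanded) indices in increasing order. -/
def Demand.coIdx {K D : ℕ} (W : Demand K D) : Fin (K - D) ↪o Fin K :=
  W.1ᶜ.orderEmbOfFin (by rw [Finset.card_compl, Fintype.card_fin, W.2])

/-- The demand is uniformly distributed. -/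
def demandLaw {K D : ℕ} (h : D ≤ K) : PMF (Demand K D) :=
  haveI := demand_nonempty h
  PMF.uniformOfFintype (Demand K D)

/-- A message of `m = L * s` symbols of `F`, divided into `L` subpackets of `s` symbols each. -/
abbrev Message (F : Type u) (L s : ℕ) : Type u := Fin L → Fin s → F

/-- The `K` messages; `X k l` is the `l`-th subpacket of the `k`-th message. -/
abbrev Database (F : Type u) (K L s : ℕ) : Type u := Fin K → Message F L s

/-- The coefficients of a linear combination of all the message subpackets. -/
abbrev Coeffs (F : Type u) (K L : ℕ) : Type u := Fin K → Fin L → F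

/-- The linear combination of the message subpackets with coefficients `v`. -/
def combine {F : Type u} [Field F] {K L s : ℕ} (v : Coeffs F K L) (X : Database F K L s) :
    Fin s → F :=
  ∑ k, ∑ l, v k l • X k l

/-- The demanded messages `X_W`. -/
def demanded {F : Type u} {K D L s : ℕ} (W : Demand K D) (X : Database F K L s) :
    Fin D → Message F L s :=
  fun c => X (W.idx c)

/-- A linear protocol with subpacketization degree `L`, for `N` servers.
Given the demand, the `N` queries are drawn jointly from `queryLaw`, independently of the messages.
Server `n` answers a query `q` by the linear combinations of the message subpackets whose
coefficient vectors are listed in `coeffs n q`. -/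
structure LinearProtocol (F : Type u) (K D L N : ℕ) where
  Query : Type u
  queryLaw : Demand K D → PMF (Fin N → Query)
  coeffs : Fin N → Query → List (Coeffs F K L)

namespace LinearProtocol

variable {F : Type u} [Field F] {K D L N : ℕ}

/-- The answer of server `n` to the query `q`. -/
def answer (P : LinearProtocol F K D L N) {s : ℕ} (n : Fin N) (q : P.Query)
    (X : Database F K L s) : List (Fin s → F) :=
  (P.coeffs n q).map fun v => combine v X

/-- The joint law of the queries and the messages, for a given demand. -/
def lawGiven [Fintype F] (P : LinearProtocol F K D L N) (s : ℕ) (W : Demand K D) :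
    PMF ((Fin N → P.Query) × Database F K L s) :=
  (P.queryLaw W).bind fun Q => (PMF.uniformOfFintype (Database F K L s)).map fun X => (Q, X)

/-- The joint law of the demand, the queries and the messages. -/
def law [Fintype F] (P : LinearProtocol F K D L N) (s : ℕ) (h : D ≤ K) :
    PMF (Demand K D × (Fin N → P.Query) × Database F K L s) :=
  (demandLaw h).bind fun W => (P.lawGiven s W).map fun QX => (W, QX)

/-- Privacy: `P(W = w | Q_n = q) = P(W = w)` for every server `n`, every demand `w` and every
query `q` that server `n` receives with positive probability. -/
def IsPrivate (P : LinearProtocol F K D L N) (h : D ≤ K) : Prop :=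
  let p : PMF (Demand K D × (Fin N → P.Query)) :=
    (demandLaw h).bind fun W => (P.queryLaw W).map fun Q => (W, Q)
  ∀ (n : Fin N) (w : Demand K D) (q : P.Query), (p.map fun ω => ω.2 n) q ≠ 0 →
    condProb p (fun ω => ω.1) (fun ω => ω.2 n) w q = demandLaw h w

/-- Recoverability: `H(X_W | A, Q) = 0` for every demand `W`, where `A` and `Q` are the
collections of all answers and of all queries. -/
def IsRecoverable [Fintype F] (P : LinearProtocol F K D L N) (s : ℕ) : Prop :=
  ∀ W : Demand K D,
    condEntropy (P.lawGiven s W) (fun ω => demanded W ω.2)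
      (fun ω => ((fun n => P.answer n (ω.1 n) ω.2), ω.1)) = 0

/-- The rate `H(X_W) / ∑_n H(A_n | Q_n)`, where the demand `W` is random too. -/
def rate [Fintype F] (P : LinearProtocol F K D L N) (s : ℕ) (h : D ≤ K) : ℝ≥0∞ :=
  entropy (P.law s h) (fun ω => demanded ω.1 ω.2.2) /
    ∑ n, condEntropy (P.law s h) (fun ω => P.answer n (ω.2.1 n) ω.2.2) (fun ω => ω.2.1 n)

end LinearProtocol

/-- The capacity: the supremum of the rates of all linear protocols with subpacketization degree
`L` that are private and recoverable, for `K` messages in `F ^ (L * s)`, `D` of them demanded, and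
`N` servers. -/
def capacity (F : Type u) [Field F] [Fintype F] {K D : ℕ} (L N s : ℕ) (h : D ≤ K) : ℝ≥0∞ :=
  ⨆ (P : LinearProtocol F K D L N) (_ : P.IsPrivate h) (_ : P.IsRecoverable s), P.rate s h

/-! The quantities in the lower and upper bounds. -/

/-- `β_j = D L / C(D, j)`. -/
def beta (D L j : ℕ) : ℝ := (D * L : ℝ) / (D.choose j : ℝ)

/-- The matrix `M`: the first row is constant with entries `1 / β_1`, the entry at
(row `r`, column `r - 1`) is `β_{r-1} / β_r` for `2 ≤ r ≤ D`, and the others are `0`.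
(The index `i : Fin D` stands for the row or column number `i + 1`.) -/
def matM (D L : ℕ) : Matrix (Fin D) (Fin D) ℝ :=
  Matrix.of fun i j =>
    if (i : ℕ) = 0 then 1 / beta D L 1
    else if (j : ℕ) + 1 = i then beta D L i / beta D L (i + 1)
    else 0

/-- `fᵀ = 1ᵀ M ^ (K - D)`. -/
def vecF (K D L : ℕ) : Fin D → ℝ := Matrix.vecMul (fun _ => 1) (matM D L ^ (K - D))

/-- `gᵀ = 1ᵀ (I + M) ^ (K - D)`. -/
def vecG (K D L : ℕ) : Fin D → ℝ := Matrix.vecMul (fun _ => 1) ((1 + matM D L) ^ (K - D))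

/-- The lower bound `D L / (N - max_j f_j / g_j)`, with `N = D L + 1`. -/
def lowerBound (K D L : ℕ) : ℝ :=
  (D * L : ℝ) / ((D * L + 1 : ℝ) - ⨆ j : Fin D, vecF K D L j / vecG K D L j)

/-- The upper bound
`((1 - 1 / N ^ ⌊K/D⌋) / (1 - 1 / N) + (K/D - ⌊K/D⌋) / N ^ ⌊K/D⌋)⁻¹`. -/
def upperBound (K D N : ℕ) : ℝ :=
  ((1 - 1 / (N : ℝ) ^ (K / D)) / (1 - 1 / (N : ℝ))
    + ((K : ℝ) / (D : ℝ) - ((K / D : ℕ) : ℝ)) * (1 / (N : ℝ) ^ (K / D)))⁻¹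

/-! The randomized scheme, for `N = D L + 1` servers. -/

/-- The numbers `P_{i,j}`: the vector `P_{K-D}` has the entry `1 / g_{j*}` at `j*` and `0`
elsewhere, and `P_i = C(K - D, i) M ^ (K - D - i) P_{K-D}` for every `i ≤ K - D`. -/
def pairProb (K D L : ℕ) (jstar : Fin D) (i : Fin (K - D + 1)) : Fin D → ℝ :=
  ((K - D).choose i : ℝ) •
    (matM D L ^ (K - D - (i : ℕ))).mulVec (Pi.single jstar (1 / vecG K D L jstar))

/-- The uniform distribution on `S` if `S` is nonempty. (The value `a` for empty `S` makes this
a total function.) -/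
def uniformOn {α : Type*} (S : Finset α) (a : α) : PMF α :=
  open Classical in if h : S.Nonempty then PMF.uniformOfFinset S h else PMF.pure a

section Scheme

variable (F : Type u) [Field F] [Fintype F]

/-- The vectors of length `n` with exactly `i` nonzero entries. -/
def sparseVectors (n i : ℕ) : Finset (Fin n → F) :=
  open Classical in
  Finset.univ.filter fun h => (Finset.univ.filter fun t => h t ≠ 0).card = i

/-- The invertible matrices whose first row has the support `J`, the support of each
further row being the circular shift of the preceding one (indices modulo `D`). -/
def regularMatrices {D : ℕ} (J : Finset (Fin D)) : Finset (Matrix (Fin D) (Fin D) F) :=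
  open Classical in
  Finset.univ.filter fun G => IsUnit G.det ∧ ∀ m c : Fin D, G m c ≠ 0 ↔ c - m ∈ J

variable {F} {K D L : ℕ}

/-- The coefficient vector of
`Y_1 = h · [X_{u_1,1}, …, X_{u_{K-D},1}]ᵀ`, where `u_1, …, u_{K-D}` are the interference
indices and the subpackets of message `k` are taken in the order
`σ k 0, σ k 1, …, σ k (L - 1)`. -/
def interferencePart (W : Demand K D) (σ : Fin K → Equiv.Perm (Fin L)) (h : Fin (K - D) → F) :
    Coeffs F K L :=
  fun k r => ∑ t, if W.coIdx t = k ∧ (((σ k).symm r : Fin L) : ℕ) = 0 then h t else 0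

/-- The coefficient vector of `g_m · [X_{w_1,l}, …, X_{w_D,l}]ᵀ`, where `w_1, …, w_D` are the
demand indices, `g_m` is the `m`-th row of `G`, and the subpackets are reordered by `σ`. -/
def demandPart (W : Demand K D) (σ : Fin K → Equiv.Perm (Fin L))
    (G : Matrix (Fin D) (Fin D) F) (l : Fin L) (m : Fin D) : Coeffs F K L :=
  fun k r => ∑ c, if W.idx c = k ∧ σ k l = r then G m c else 0

/-- The `N = D L + 1` coefficient vectors: that of `Y_1` has the label `none`, and
that of `Y_{(l-1)D+m+1} = Y_1 + g_m · [X_{w_1,l}, …, X_{w_D,l}]ᵀ` has the label `(l, m)`. -/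
def schemeVector (W : Demand K D) (σ : Fin K → Equiv.Perm (Fin L)) (h : Fin (K - D) → F)
    (G : Matrix (Fin D) (Fin D) F) : Option (Fin L × Fin D) → Coeffs F K L
  | none => interferencePart W σ h
  | some (l, m) => interferencePart W σ h + demandPart W σ G l m

instance : Nonempty (Fin (D * L + 1) ≃ Option (Fin L × Fin D)) :=
  ⟨Fintype.equivOfCardEq (by simp [mul_comm])⟩

/-- The scheme, for a law `p` of the pair `(i, j)` (the second component `b : Fin D` stands for
`j = b + 1`). Draw `(i, j)` from `p`; then draw uniformly at random an `i`-sparse vector `h`, a set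
`J` of `j` positions, an invertible matrix `G` with the supports given by `J`, the orders `σ` of the
subpackets of the messages, and a bijection `π` between the servers and the `N` vectors.
Server `n` receives the vector that `π` assigns to it, and answers by this one combination. -/
def scheme (p : PMF (Fin (K - D + 1) × Fin D)) : LinearProtocol F K D L (D * L + 1) where
  Query := Coeffs F K L
  queryLaw W :=
    p.bind fun ij =>
    (uniformOn (sparseVectors F (K - D) (ij.1 : ℕ)) 0).bind fun h =>
    (uniformOn (Finset.powersetCard ((ij.2 : ℕ) + 1) (Finset.univ : Finset (Fin D))) ∅).bind fun J =>
    (uniformOn (regularMatrices F J) 1).bind fun G =>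
    (PMF.uniformOfFintype (Fin K → Equiv.Perm (Fin L))).bind fun σ =>
    (PMF.uniformOfFintype (Fin (D * L + 1) ≃ Option (Fin L × Fin D))).map fun π =>
      fun n => schemeVector W σ h G (π n)
  coeffs _ v := [v]

end Scheme

end MPIR

end

noncomputable section

namespace MPIR

/-! Uniform laws and their images. -/

/-! Everything reduces to linear algebra. For a uniform database the answer to a fixed query is
uniform on a set of size `q ^ (s * d)`, where `d` is the dimension of the span of its coefficient
vectors. Hence the rate is `D * L` divided by the expected sum of these dimensions
(`LinearProtocol.rate_eq`). Recoverability says that the spans of the answers jointly contain all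
demanded subpackets (`LinearProtocol.isRecoverable_iff`), and privacy that the law of each single
query is the same for all demands (`LinearProtocol.isPrivate_iff`).

Converse. Measure ranks modulo a set `S` of messages, and let `E S` be the expected sum over the
servers. If the answers decode `W`, subadditivity and monotonicity give `E S ≥ |W \ S| L + E (S ∪ W)
/ N` (`LinearProtocol.le_expectedRankModulo`). Privacy permits a different demand at every step,
because each summand of `E` depends on one query only. Starting from `S = ∅` and taking `D` new
messages at a time gives a geometric sum plus one term for the remaining `K % D` messages.

Achievability. A single query has at most one nonzero coefficient per message, at a uniformly random
subpacket, so only the law of the coefficient vector `a` in `F ^ K` could reveal the demand. If `a`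
has `i` nonzero interference entries and `k` nonzero demand entries, its probability is `level i k /
(N (q - 1) ^ (i + k))` (`coefficientLaw_eq_level`). The matrix `M` is designed so that `level i (k +
1) = level (i + 1) k`. Thus the probability depends only on the support size of `a`, whatever the
demand (`level_congr`). The zero query saves one download and has probability `(f / g) / N` at each
server, so the expected rank is `N - f / g`; the choice of `j*` maximizes this saving and plays no
role in privacy. Decoding subtracts `Y_1` and inverts the random matrix, whose existence for every
support pattern is where `q ≥ 3` enters (`hasRegularMatrices`). -/

lemma uniformOn_of_nonempty {α : Type*} {S : Finset α} (hS : S.Nonempty) (a : α) :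
    uniformOn S a = PMF.uniformOfFinset S hS := by
  simp [uniformOn, hS]

lemma uniformOn_apply_of_mem {α : Type*} {S : Finset α} {x : α} (hx : x ∈ S) (a : α) :
    uniformOn S a x = (S.card : ℝ≥0∞)⁻¹ := by
  have hS : S.Nonempty := ⟨x, hx⟩
  rw [uniformOn_of_nonempty hS, PMF.uniformOfFinset_apply_of_mem hS hx]

lemma uniformOn_apply_of_notMem {α : Type*} {S : Finset α} (hS : S.Nonempty) {x : α}
    (hx : x ∉ S) (a : α) : uniformOn S a x = 0 := by
  rw [uniformOn_of_nonempty hS, PMF.uniformOfFinset_apply_of_notMem _ hx]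

lemma uniformOfFintype_eq_uniformOn {α : Type*} [Fintype α] [Nonempty α] (a : α) :
    PMF.uniformOfFintype α = uniformOn Finset.univ a := by
  rw [uniformOn_of_nonempty Finset.univ_nonempty]; rfl

/-- A law that is constant on `T` and vanishes off `T` is uniform on `T`. -/
lemma eq_uniformOn {α : Type*} (μ : PMF α) (T : Finset α) (h0 : ∀ y, y ∉ T → μ y = 0)
    (hc : ∀ y ∈ T, ∀ y' ∈ T, μ y ≤ μ y') (a : α) : μ = uniformOn T a := by
  have hsum : ∑ y ∈ T, μ y = 1 := by
    rw [← μ.tsum_coe, tsum_eq_sum fun y hy => h0 y hy]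
  have hT : T.Nonempty := by
    rcases T.eq_empty_or_nonempty with rfl | h
    · simp at hsum
    · exact h
  ext x
  by_cases hx : x ∈ T
  · rw [uniformOn_apply_of_mem hx]
    have : ∑ y ∈ T, μ y = T.card * μ x := by
      rw [Finset.sum_congr rfl fun y hy => le_antisymm (hc y hy x hx) (hc x hx y hy)]
      simp
    rw [hsum] at this
    exact ENNReal.eq_inv_of_mul_eq_one_left (by rw [mul_comm, ← this])
  · rw [uniformOn_apply_of_notMem hT hx, h0 x hx]

/-- An injection of one fibre into another that does not decrease mass compares their total masses.
Uniformity of images is proved below by such explicit symmetries instead of counting fibres. -/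
lemma map_apply_le_map_apply {α β : Type*} (μ : PMF α) (f : α → β) {y y' : β} (e : α → α)
    (he : Function.Injective e)
    (h : ∀ x, μ x ≠ 0 → f x = y → μ x ≤ μ (e x) ∧ f (e x) = y') :
    μ.map f y ≤ μ.map f y' := by
  classical
  rw [PMF.map_apply, PMF.map_apply]
  refine le_trans (ENNReal.tsum_le_tsum fun x => ?_)
    (ENNReal.tsum_comp_le_tsum_of_injective he fun x => if y' = f x then μ x else 0)
  by_cases hx : μ x = 0
  · simp [hx]
  by_cases hy : y = f x
  · obtain ⟨h1, h2⟩ := h x hx hy.symm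
    simpa [hy, h2] using h1
  · simp [hy]

/-- The image of a uniform law is uniform if the fibres can be mapped into each other. -/
lemma uniformOn_map {α β : Type*} {S : Finset α} (hS : S.Nonempty) (T : Finset β) (f : α → β)
    (hf : ∀ x ∈ S, f x ∈ T)
    (ht : ∀ y ∈ T, ∀ y' ∈ T, ∃ e : α → α, Function.Injective e ∧
      ∀ x ∈ S, f x = y → e x ∈ S ∧ f (e x) = y') (a : α) (b : β) :
    (uniformOn S a).map f = uniformOn T b := by
  refine eq_uniformOn _ _ (fun y hy => ?_) (fun y hy y' hy' => ?_) b
  · rw [PMF.map_apply, ENNReal.tsum_eq_zero]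
    intro x
    by_cases hx : x ∈ S
    · rw [if_neg]
      rintro rfl
      exact hy (hf x hx)
    · simp [uniformOn_apply_of_notMem hS hx]
  · obtain ⟨e, he, h⟩ := ht y hy y' hy'
    refine map_apply_le_map_apply _ f e he fun x hx hxy => ?_
    have hxS : x ∈ S := by
      by_contra hn
      exact hx (uniformOn_apply_of_notMem hS hn a)
    obtain ⟨h1, h2⟩ := h x hxS hxy
    exact ⟨by rw [uniformOn_apply_of_mem hxS, uniformOn_apply_of_mem h1], h2⟩

lemma uniformOfFintype_map {α β : Type*} [Fintype α] [Nonempty α] [Fintype β] [Nonempty β]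
    (f : α → β) (ht : ∀ y y', ∃ e : α → α, Function.Injective e ∧
      ∀ x, f x = y → f (e x) = y') :
    (PMF.uniformOfFintype α).map f = PMF.uniformOfFintype β := by
  rw [uniformOfFintype_eq_uniformOn (Classical.arbitrary α),
    uniformOfFintype_eq_uniformOn (Classical.arbitrary β)]
  refine uniformOn_map Finset.univ_nonempty _ f (by simp) (fun y _ y' _ => ?_) _ _
  obtain ⟨e, he, h⟩ := ht y y'
  exact ⟨e, he, fun x _ hx => ⟨Finset.mem_univ _, h x hx⟩⟩

lemma tsum_map_mul {α β : Type*} (μ : PMF α) (f : α → β) (g : β → ℝ≥0∞) :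
    ∑' b, μ.map f b * g b = ∑' a, μ a * g (f a) := by
  classical
  simp_rw [PMF.map_apply, ← ENNReal.tsum_mul_right]
  rw [ENNReal.tsum_comm]
  refine tsum_congr fun a => ?_
  rw [tsum_eq_single (f a)]
  · simp
  · intro b hb
    simp [hb]

lemma tsum_bind_mul {α β : Type*} (μ : PMF α) (κ : α → PMF β) (g : β → ℝ≥0∞) :
    ∑' b, μ.bind κ b * g b = ∑' a, μ a * ∑' b, κ a b * g b := by
  simp_rw [PMF.bind_apply, ← ENNReal.tsum_mul_right, ← ENNReal.tsum_mul_left]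
  rw [ENNReal.tsum_comm]
  simp_rw [mul_assoc]

lemma bind_map_prodMk_apply {α β : Type*} (μ : PMF β) (κ : β → PMF α) (y : α) (z : β) :
    (μ.bind fun z => (κ z).map fun y => (y, z)) (y, z) = μ z * κ z y := by
  classical
  rw [PMF.bind_apply, tsum_eq_single z]
  · rw [PMF.map_apply, tsum_eq_single y]
    · simp
    · intro b hb
      simp [hb.symm]
  · intro b hb
    rw [PMF.map_apply]
    simp [hb.symm]

/-! Entropies. -/

/-- The entropy of a law. -/
def lawEntropy {α : Type*} (μ : PMF α) : ℝ≥0∞ :=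
  ∑' y, ENNReal.ofReal (Real.negMulLog (μ y).toReal / Real.log 2)

/-- Computes a conditional entropy from any two-stage sampling of the pair. The kernel is arbitrary
where `μ z = 0`, since the weight there vanishes. -/
lemma condEntropy_eq {Ω α β : Type*} (p : PMF Ω) (Y : Ω → α) (Z : Ω → β) (μ : PMF β)
    (κ : β → PMF α)
    (h : (p.map fun ω => (Y ω, Z ω)) = μ.bind fun z => (κ z).map fun y => (y, z)) :
    condEntropy p Y Z = ∑' z, μ z * lawEntropy (κ z) := by
  have hZ : p.map Z = μ := by
    have : p.map Z = (p.map fun ω => (Y ω, Z ω)).map Prod.snd := by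
      rw [PMF.map_comp]; rfl
    rw [this, h, PMF.map_bind]
    simp_rw [PMF.map_comp]
    have : ∀ z, PMF.map (Prod.snd ∘ fun y : α => (y, z)) (κ z) = PMF.pure z := fun z =>
      PMF.map_const _ _
    simp_rw [this, PMF.bind_pure]
  unfold condEntropy
  rw [hZ]
  refine tsum_congr fun z => ?_
  by_cases hz : μ z = 0
  · simp [hz]
  congr 1
  refine tsum_congr fun y => ?_
  rw [condProb, h, hZ, bind_map_prodMk_apply, mul_comm,
    ENNReal.mul_div_cancel_right hz (μ.apply_ne_top z)]

/-- If all the positive probabilities are equal to `c`, then the entropy is `- log c`. -/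
lemma lawEntropy_of_const {α : Type*} (μ : PMF α) (c : ℝ≥0∞)
    (h : ∀ y, μ y ≠ 0 → μ y = c) :
    lawEntropy μ = ENNReal.ofReal (-Real.log c.toReal / Real.log 2) := by
  have key : ∀ y, ENNReal.ofReal (Real.negMulLog (μ y).toReal / Real.log 2)
      = μ y * ENNReal.ofReal (-Real.log c.toReal / Real.log 2) := by
    intro y
    by_cases hy : μ y = 0
    · simp [hy]
    · rw [h y hy, Real.negMulLog]
      nth_rw 3 [← ENNReal.ofReal_toReal (h y hy ▸ μ.apply_ne_top y : c ≠ ⊤)]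
      rw [← ENNReal.ofReal_mul ENNReal.toReal_nonneg]
      congr 1
      ring
  unfold lawEntropy
  simp_rw [key, ENNReal.tsum_mul_right, μ.tsum_coe, one_mul]

/-- All summands are nonnegative, so zero entropy forces every value of positive probability to have
conditional probability one, and two different values over the same `z` would have too much mass. -/
lemma condEntropy_eq_zero_iff {Ω α β : Type*} (p : PMF Ω) (Y : Ω → α) (Z : Ω → β) :
    condEntropy p Y Z = 0 ↔
      ∀ ω ω', p ω ≠ 0 → p ω' ≠ 0 → Z ω = Z ω' → Y ω = Y ω' := by
  classical
  have hle : ∀ y z, (p.map fun ω => (Y ω, Z ω)) (y, z) ≤ p.map Z z := by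
    intro y z
    rw [PMF.map_apply, PMF.map_apply]
    refine ENNReal.tsum_le_tsum fun ω => ?_
    by_cases h : z = Z ω
    · by_cases h' : y = Y ω <;> simp [h, h']
    · simp [h]
  have hpos : ∀ ω, p ω ≠ 0 → (p.map fun ω => (Y ω, Z ω)) (Y ω, Z ω) ≠ 0 := by
    intro ω hω
    rw [← PMF.mem_support_iff, PMF.mem_support_map_iff]
    exact ⟨ω, hω, rfl⟩
  constructor
  · intro h ω ω' hω hω' hZ
    have one : ∀ ω, p ω ≠ 0 → (p.map fun ω => (Y ω, Z ω)) (Y ω, Z ω) = p.map Z (Z ω) := by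
      intro ω hω
      have hm : p.map Z (Z ω) ≠ 0 := fun h0 => hpos ω hω (le_zero_iff.1 (h0 ▸ hle _ _))
      have h1 := (mul_eq_zero.1 (ENNReal.tsum_eq_zero.1 h (Z ω))).resolve_left hm
      have h2 := ENNReal.tsum_eq_zero.1 h1 (Y ω)
      rw [ENNReal.ofReal_eq_zero, div_nonpos_iff] at h2
      have hlog : 0 < Real.log 2 := Real.log_pos (by norm_num)
      have h3 : Real.negMulLog (condProb p Y Z (Y ω) (Z ω)).toReal ≤ 0 := by
        rcases h2 with h2 | h2
        · linarith [h2.2]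
        · exact h2.1
      have hc1 : condProb p Y Z (Y ω) (Z ω) ≤ 1 :=
        ENNReal.div_le_of_le_mul (by rw [one_mul]; exact hle _ _)
      have hctop : condProb p Y Z (Y ω) (Z ω) ≠ ⊤ := ne_top_of_le_ne_top ENNReal.one_ne_top hc1
      have hc0 : condProb p Y Z (Y ω) (Z ω) ≠ 0 := by
        rw [condProb, Ne, ENNReal.div_eq_zero_iff, not_or]
        exact ⟨hpos ω hω, PMF.apply_ne_top _ _⟩
      have h4 : (condProb p Y Z (Y ω) (Z ω)).toReal = 1 := by
        have hx0 := ENNReal.toReal_pos hc0 hctop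
        have hx1 : (condProb p Y Z (Y ω) (Z ω)).toReal ≤ 1 := by
          simpa using ENNReal.toReal_mono ENNReal.one_ne_top hc1
        by_contra hne
        have := Real.log_neg hx0 (lt_of_le_of_ne hx1 hne)
        rw [Real.negMulLog] at h3
        nlinarith
      have h5 : condProb p Y Z (Y ω) (Z ω) = 1 := by
        rw [← ENNReal.ofReal_toReal hctop, h4, ENNReal.ofReal_one]
      rwa [condProb, ENNReal.div_eq_one_iff hm (PMF.apply_ne_top _ _)] at h5
    by_contra hne
    -- Distinct values of `Y` have disjoint fibres inside the fibre of `Z`; yet each of the two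
    -- carries the whole mass of that fibre.
    have hadd : (p.map fun ω => (Y ω, Z ω)) (Y ω, Z ω) + (p.map fun ω => (Y ω, Z ω)) (Y ω', Z ω)
        ≤ p.map Z (Z ω) := by
      rw [PMF.map_apply, PMF.map_apply, PMF.map_apply, ← ENNReal.tsum_add]
      refine ENNReal.tsum_le_tsum fun x => ?_
      by_cases h : Z ω = Z x
      · by_cases h' : Y ω = Y x
        · have : Y ω' ≠ Y x := fun h'' => hne (h'.trans h''.symm)
          simp [h, h', this]
        · by_cases h'' : Y ω' = Y x <;> simp [h, h', h'']
      · simp [h]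
    have h2 := one ω' hω'
    rw [← hZ] at h2
    rw [one ω hω, h2] at hadd
    have hm : p.map Z (Z ω) ≠ 0 := fun h0 => hpos ω hω (le_zero_iff.1 (h0 ▸ hle _ _))
    exact absurd hadd (not_le.2 (ENNReal.lt_add_right (PMF.apply_ne_top _ _) hm))
  · intro h
    refine ENNReal.tsum_eq_zero.2 fun z => mul_eq_zero.2 (or_iff_not_imp_left.2 fun hz => ?_)
    refine ENNReal.tsum_eq_zero.2 fun y => ?_
    by_cases hy : (p.map fun ω => (Y ω, Z ω)) (y, z) = 0
    · simp [condProb, hy]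
    · obtain ⟨ω, hω, hyz⟩ := (PMF.mem_support_map_iff _ _ _).1 ((PMF.mem_support_iff _ _).2 hy)
      obtain ⟨rfl, rfl⟩ := Prod.mk.inj hyz
      have : (p.map fun ω => (Y ω, Z ω)) (Y ω, Z ω) = p.map Z (Z ω) := by
        refine le_antisymm (hle _ _) ?_
        rw [PMF.map_apply, PMF.map_apply]
        refine ENNReal.tsum_le_tsum fun x => ?_
        by_cases hx : p x = 0
        · simp [hx]
        by_cases hzx : Z ω = Z x
        · simp [hzx, h ω x hω hx hzx]
        · simp [hzx]
      rw [condProb, this, ENNReal.div_self hz (PMF.apply_ne_top _ _)]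
      simp

lemma lawEntropy_uniformOfFintype {α : Type*} [Fintype α] [Nonempty α] :
    lawEntropy (PMF.uniformOfFintype α)
      = ENNReal.ofReal (Real.log (Fintype.card α) / Real.log 2) := by
  rw [lawEntropy_of_const _ ((Fintype.card α : ℝ≥0∞)⁻¹) (fun y _ => by simp)]
  simp

lemma uniformOfFintype_map_addHom {A B : Type*} [AddGroup A] [AddGroup B] [Fintype A] [Fintype B]
    (f : A →+ B) (hf : Function.Surjective f) :
    (PMF.uniformOfFintype A).map f = PMF.uniformOfFintype B := by
  refine uniformOfFintype_map f fun y y' => ?_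
  obtain ⟨a, ha⟩ := hf (y' - y)
  exact ⟨fun x => a + x, add_right_injective a, fun x hx => by simp [ha, hx]⟩

/-! ### Databases as tuples of linear forms on coefficient vectors -/

section Linear

variable {F : Type u} [Field F] {K L s : ℕ}

/-- The coefficient vector of the `l`-th subpacket of message `k`. -/
def unitVec (k : Fin K) (l : Fin L) : Coeffs F K L := Pi.single k (Pi.single l 1)

lemma sum_smul_unitVec (v : Coeffs F K L) : ∑ k, ∑ l, v k l • unitVec k l = v := by
  ext k l
  simp only [Finset.sum_apply, Pi.smul_apply, smul_eq_mul, unitVec]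
  rw [Finset.sum_eq_single k, Finset.sum_eq_single l]
  · simp
  · intro b _ hb
    simp [hb.symm]
  · simp
  · intro b _ hb
    refine Finset.sum_eq_zero fun c _ => ?_
    simp [hb.symm]
  · simp

/-- The linear form that evaluates the `t`-th symbol of the linear combinations of `X`. -/
def symbolForm (X : Database F K L s) (t : Fin s) : Module.Dual F (Coeffs F K L) where
  toFun v := combine v X t
  map_add' v w := by simp [combine, add_mul, Finset.sum_add_distrib]
  map_smul' c v := by simp [combine, Finset.mul_sum, mul_assoc]

lemma symbolForm_apply (X : Database F K L s) (t : Fin s) (v : Coeffs F K L) :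
    symbolForm X t v = combine v X t := rfl

lemma combine_add_right (v : Coeffs F K L) (X Y : Database F K L s) :
    combine v (X + Y) = combine v X + combine v Y := by
  simp [combine, Finset.sum_add_distrib]

lemma combine_unitVec (X : Database F K L s) (k : Fin K) (l : Fin L) :
    combine (unitVec k l) X = X k l := by
  unfold combine unitVec
  rw [Finset.sum_eq_single k, Finset.sum_eq_single l]
  · simp
  · intro b _ hb
    simp [hb]
  · simp
  · intro b _ hb
    refine Finset.sum_eq_zero fun c _ => ?_
    simp [hb]
  · simp

/-- The database all of whose symbol forms are given. -/
def databaseOfForms (φ : Fin s → Module.Dual F (Coeffs F K L)) : Database F K L s :=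
  fun k l t => φ t (unitVec k l)

lemma symbolForm_databaseOfForms (φ : Fin s → Module.Dual F (Coeffs F K L)) (t : Fin s) :
    symbolForm (databaseOfForms φ) t = φ t := by
  refine LinearMap.ext fun v => ?_
  conv_rhs => rw [← sum_smul_unitVec v]
  simp [symbolForm_apply, combine, databaseOfForms, map_sum]

/-- The space spanned by a list of coefficient vectors. -/
def listSpan (c : List (Coeffs F K L)) : Submodule F (Coeffs F K L) :=
  Submodule.span F {v | v ∈ c}

/-- The symbol forms restricted to a subspace of coefficient vectors. -/
def restrictForms (V : Submodule F (Coeffs F K L)) (s : ℕ) :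
    Database F K L s →+ (Fin s → Module.Dual F V) where
  toFun X t := (symbolForm X t).comp V.subtype
  map_zero' := by
    ext t v
    simp [symbolForm_apply, combine]
  map_add' X Y := by
    ext t v
    simp [symbolForm_apply, combine_add_right]

/-- A form on `V` extends to all coefficient vectors, and a tuple of forms there is a database.
Being additive, the restriction therefore maps a uniform database to uniform forms on `V`. -/
lemma restrictForms_surjective (V : Submodule F (Coeffs F K L)) (s : ℕ) :
    Function.Surjective (restrictForms V s) := by
  intro ψ
  choose φ hφ using fun t => LinearMap.exists_extend (ψ t)
  refine ⟨databaseOfForms φ, funext fun t => ?_⟩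
  rw [← hφ t, ← symbolForm_databaseOfForms φ t]
  rfl

/-- The entropy of the answer to a fixed query. -/
lemma lawEntropy_map_combine [Fintype F] (c : List (Coeffs F K L)) (s : ℕ) :
    lawEntropy ((PMF.uniformOfFintype (Database F K L s)).map fun X => c.map fun v => combine v X)
      = ENNReal.ofReal (s * Real.log (Fintype.card F) / Real.log 2)
        * (Module.finrank F (listSpan c) : ℝ≥0∞) := by
  classical
  let V := listSpan c
  have : Finite (Fin s → Module.Dual F V) := Module.finite_of_finite F
  have : Fintype (Fin s → Module.Dual F V) := Fintype.ofFinite _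
  -- The answer depends only on the forms restricted to `V`; it determines them, because the list
  -- spans `V`. So it is uniform on as many values as there are tuples of forms.
  let g : (Fin s → Module.Dual F V) → List (Fin s → F) := fun φ =>
    c.attach.map fun v => fun t => φ t ⟨v.1, Submodule.subset_span v.2⟩
  have hg : Function.Injective g := by
    intro φ ψ h
    have h1 := List.map_inj_left.1 h
    funext t
    have : (Submodule.span F {v : V | v.1 ∈ c}) = ⊤ := by
      have := Submodule.span_span_coe_preimage (R := F) (s := {v : Coeffs F K L | v ∈ c})
      exact this
    refine LinearMap.ext_on this fun v hv => ?_
    exact congrFun (h1 ⟨v.1, hv⟩ (List.mem_attach _ _)) t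
  have hmap : (PMF.uniformOfFintype (Database F K L s)).map (fun X => c.map fun v => combine v X)
      = (PMF.uniformOfFintype (Fin s → Module.Dual F V)).map g := by
    rw [← uniformOfFintype_map_addHom _ (restrictForms_surjective V s), PMF.map_comp]
    congr 1
    funext X
    simp only [g, Function.comp_apply]
    conv_lhs => rw [← List.attach_map_subtype_val c]
    rw [List.map_map]
    rfl
  rw [hmap, lawEntropy_of_const _ ((Fintype.card (Fin s → Module.Dual F V) : ℝ≥0∞)⁻¹)]
  · have hcard : Fintype.card (Fin s → Module.Dual F V)
        = Fintype.card F ^ (s * Module.finrank F V) := by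
      rw [Module.card_eq_pow_finrank (K := F), Module.finrank_pi_fintype]
      simp [Subspace.dual_finrank_eq]
    rw [hcard, ← ENNReal.ofReal_natCast (Module.finrank F (listSpan c)),
      ← ENNReal.ofReal_mul (by positivity)]
    congr 1
    rw [ENNReal.toReal_inv, Real.log_inv, ENNReal.toReal_natCast]
    push_cast
    rw [Real.log_pow]
    push_cast
    ring
  · intro y hy
    obtain ⟨φ, -, rfl⟩ := (PMF.mem_support_map_iff _ _ _).1 ((PMF.mem_support_iff _ _).2 hy)
    rw [PMF.map_apply, tsum_eq_single φ]
    · simp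
    · intro ψ hψ
      rw [if_neg fun h => hψ (hg h).symm]

end Linear

/-! ### Rate, recoverability and privacy in linear-algebraic terms -/

namespace LinearProtocol

variable {F : Type u} [Field F] {K D L N : ℕ}

/-- The law of the query to server `n`, for a random demand. -/
def queryMarginal (P : LinearProtocol F K D L N) (h : D ≤ K) (n : Fin N) : PMF P.Query :=
  (demandLaw h).bind fun W => (P.queryLaw W).map fun Q => Q n

/-- The expected total number of independent combinations in the answers. -/
def expectedRank (P : LinearProtocol F K D L N) (h : D ≤ K) : ℝ≥0∞ :=
  ∑ n, ∑' q, P.queryMarginal h n q * (Module.finrank F (listSpan (P.coeffs n q)) : ℝ≥0∞)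

lemma condEntropy_answer [Fintype F] (P : LinearProtocol F K D L N) (s : ℕ) (h : D ≤ K)
    (n : Fin N) :
    condEntropy (P.law s h) (fun ω => P.answer n (ω.2.1 n) ω.2.2) (fun ω => ω.2.1 n)
      = ENNReal.ofReal (s * Real.log (Fintype.card F) / Real.log 2) *
        ∑' q, P.queryMarginal h n q * (Module.finrank F (listSpan (P.coeffs n q)) : ℝ≥0∞) := by
  rw [condEntropy_eq _ _ _ (P.queryMarginal h n)
    fun q => (PMF.uniformOfFintype (Database F K L s)).map fun X => P.answer n q X]
  · rw [← ENNReal.tsum_mul_left]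
    refine tsum_congr fun q => ?_
    unfold answer
    rw [lawEntropy_map_combine]
    ring
  · unfold law lawGiven queryMarginal
    simp only [PMF.map_bind, PMF.bind_bind, PMF.map_comp, PMF.bind_map]
    rfl

lemma entropy_demanded [Fintype F] (P : LinearProtocol F K D L N) (s : ℕ) (h : D ≤ K) :
    entropy (P.law s h) (fun ω => demanded ω.1 ω.2.2)
      = ENNReal.ofReal (s * Real.log (Fintype.card F) / Real.log 2) * (D * L : ℝ≥0∞) := by
  have hW : ∀ W : Demand K D, (PMF.uniformOfFintype (Database F K L s)).map (demanded W)
      = PMF.uniformOfFintype (Fin D → Message F L s) := by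
    intro W
    refine uniformOfFintype_map_addHom
      (AddMonoidHom.mk' (demanded W) fun X Y => rfl : Database F K L s →+ _) fun y => ?_
    refine ⟨fun k => if hk : ∃ c, W.idx c = k then y hk.choose else 0, funext fun c => ?_⟩
    have hc : ∃ c', W.idx c' = W.idx c := ⟨c, rfl⟩
    change (if hk : ∃ c', W.idx c' = W.idx c then y hk.choose else 0) = y c
    rw [dif_pos hc, W.idx.injective hc.choose_spec]
  have : (P.law s h).map (fun ω => demanded ω.1 ω.2.2)
      = PMF.uniformOfFintype (Fin D → Message F L s) := by
    unfold law lawGiven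
    simp only [PMF.map_bind, PMF.map_comp]
    have h2 : ∀ (W : Demand K D) (Q : Fin N → P.Query),
        PMF.map ((((fun ω : Demand K D × (Fin N → P.Query) × Database F K L s =>
          demanded ω.1 ω.2.2) ∘ fun QX => (W, QX))) ∘ fun X => (Q, X))
          (PMF.uniformOfFintype (Database F K L s))
        = PMF.uniformOfFintype (Fin D → Message F L s) := fun W Q => hW W
    simp_rw [Function.comp_assoc] at h2 ⊢
    simp_rw [h2, PMF.bind_const]
  change lawEntropy ((P.law s h).map _) = _
  rw [this, lawEntropy_uniformOfFintype]
  have hc : Fintype.card (Fin D → Message F L s) = Fintype.card F ^ (D * L * s) := by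
    simp [Message, ← pow_mul, mul_comm, mul_left_comm]
  have hDL : (D * L : ℝ≥0∞) = ENNReal.ofReal (D * L : ℝ) := by
    rw [ENNReal.ofReal_mul (by positivity), ENNReal.ofReal_natCast, ENNReal.ofReal_natCast]
  rw [hc, hDL, ← ENNReal.ofReal_mul (by positivity)]
  congr 1
  push_cast
  rw [Real.log_pow]
  push_cast
  ring

/-- The common factor `s log q / log 2` cancels; it is nonzero because `s ≥ 1` and `q ≥ 2`. -/
lemma rate_eq [Fintype F] (P : LinearProtocol F K D L N) {s : ℕ} (hs : 1 ≤ s) (h : D ≤ K) :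
    P.rate s h = (D * L : ℝ≥0∞) / P.expectedRank h := by
  unfold rate expectedRank
  simp_rw [condEntropy_answer, entropy_demanded, ← Finset.mul_sum]
  refine ENNReal.mul_div_mul_left _ _ ?_ ENNReal.ofReal_ne_top
  have h1 : 0 < Real.log (Fintype.card F) :=
    Real.log_pos (by exact_mod_cast Fintype.one_lt_card)
  have h2 : 0 < Real.log 2 := Real.log_pos (by norm_num)
  have h3 : (0 : ℝ) < s := by exact_mod_cast hs
  rw [Ne, ENNReal.ofReal_eq_zero, not_le]
  positivity

lemma lawGiven_apply_ne_zero [Fintype F] (P : LinearProtocol F K D L N) {s : ℕ} (W : Demand K D)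
    (ω : (Fin N → P.Query) × Database F K L s) :
    P.lawGiven s W ω ≠ 0 ↔ P.queryLaw W ω.1 ≠ 0 := by
  simp only [← PMF.mem_support_iff, lawGiven, PMF.mem_support_bind_iff, PMF.mem_support_map_iff,
    PMF.mem_support_uniformOfFintype, true_and]
  constructor
  · rintro ⟨Q, hQ, X, rfl⟩
    exact hQ
  · intro h
    exact ⟨ω.1, h, ω.2, rfl⟩

/-- Recoverability: the subpackets of the demanded messages are in the span of the answers. -/
lemma isRecoverable_iff [Fintype F] (P : LinearProtocol F K D L N) {s : ℕ} (hs : 1 ≤ s) :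
    P.IsRecoverable s ↔ ∀ (W : Demand K D) (Q : Fin N → P.Query), P.queryLaw W Q ≠ 0 →
      ∀ (c : Fin D) (l : Fin L),
        unitVec (W.idx c) l ∈ ⨆ n, listSpan (P.coeffs n (Q n)) := by
  have hans : ∀ (n : Fin N) (q : P.Query) (X Y : Database F K L s),
      P.answer n q X = P.answer n q Y ↔ ∀ v ∈ P.coeffs n q, combine v X = combine v Y :=
    fun n q X Y => List.map_inj_left
  refine forall_congr' fun W => ?_
  rw [condEntropy_eq_zero_iff]
  constructor
  · intro h Q hQ c l
    by_contra hmem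
    -- A form that kills all answers but not the missing subpacket, read as a database, cannot be
    -- told apart from the zero database.
    obtain ⟨φ, hφ, hV⟩ := Submodule.exists_le_ker_of_notMem hmem
    let X : Database F K L s := databaseOfForms fun _ => φ
    have hX : ∀ v : Coeffs F K L, ∀ t, combine v X t = φ v := fun v t => by
      rw [← symbolForm_apply, symbolForm_databaseOfForms]
    have key := h (Q, X) (Q, 0) ((P.lawGiven_apply_ne_zero W _).2 hQ)
      ((P.lawGiven_apply_ne_zero W _).2 hQ) (by
        refine Prod.ext (funext fun n => (hans n _ _ _).2 fun v hv => funext fun t => ?_) rfl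
        have hv' : v ∈ ⨆ n, listSpan (P.coeffs n (Q n)) :=
          Submodule.mem_iSup_of_mem n (Submodule.subset_span hv)
        rw [hX, show φ v = 0 from hV hv']
        simp [combine])
    have h1 : X (W.idx c) l = 0 := congrFun (congrFun key c) l
    have h2 := hX (unitVec (W.idx c) l) ⟨0, hs⟩
    rw [combine_unitVec, h1] at h2
    exact hφ h2.symm
  · rintro h ⟨Q, X⟩ ⟨Q', Y⟩ hQ - hZ
    obtain ⟨hA, rfl⟩ := Prod.mk.inj hZ
    have hQ' := (P.lawGiven_apply_ne_zero W _).1 hQ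
    have hle : ∀ t, (⨆ n, listSpan (P.coeffs n (Q n)))
        ≤ LinearMap.ker (symbolForm X t - symbolForm Y t) := by
      refine fun t => iSup_le fun n => Submodule.span_le.2 fun v hv => ?_
      have := (hans n _ _ _).1 (congrFun hA n) v hv
      simp [symbolForm_apply, this]
    funext c l t
    have := hle t (h Q hQ' c l)
    rw [LinearMap.mem_ker, LinearMap.sub_apply, symbolForm_apply, symbolForm_apply,
      combine_unitVec, combine_unitVec, sub_eq_zero] at this
    exact this

/-- Privacy: the law of the query to a server does not depend on the demand. -/
lemma isPrivate_iff {F : Type u} (P : LinearProtocol F K D L N) (h : D ≤ K) :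
    P.IsPrivate h ↔ ∀ (n : Fin N) (W : Demand K D),
      (P.queryLaw W).map (fun Q => Q n) = P.queryMarginal h n := by
  classical
  have hmarg : ∀ n, ((demandLaw h).bind fun W => (P.queryLaw W).map fun Q => (W, Q)).map
      (fun ω => ω.2 n) = P.queryMarginal h n := by
    intro n
    simp only [PMF.map_bind, PMF.map_comp]
    rfl
  have hjoint : ∀ n w q, (((demandLaw h).bind fun W => (P.queryLaw W).map fun Q => (W, Q)).map
      (fun ω => (ω.1, ω.2 n))) (w, q) = demandLaw h w * (P.queryLaw w).map (fun Q => Q n) q := by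
    intro n w q
    simp only [PMF.map_bind, PMF.map_comp]
    rw [PMF.bind_apply, tsum_eq_single w]
    · congr 1
      rw [PMF.map_apply, PMF.map_apply]
      simp
    · intro b hb
      rw [PMF.map_apply]
      simp [hb.symm]
  have hpos : ∀ w, demandLaw h w ≠ 0 := by
    intro w
    have := demand_nonempty h
    simp [demandLaw]
  unfold IsPrivate condProb
  simp only [hmarg, hjoint]
  refine forall_congr' fun n => forall_congr' fun w => ?_
  -- Each demand has positive probability, so a query that never occurs on average never occurs for
  -- any demand; privacy imposes nothing there and nothing is lost.
  have hzero : ∀ q, P.queryMarginal h n q = 0 → (P.queryLaw w).map (fun Q => Q n) q = 0 := by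
    intro q hq
    rw [queryMarginal, PMF.bind_apply, ENNReal.tsum_eq_zero] at hq
    exact (mul_eq_zero.1 (hq w)).resolve_left (hpos w)
  constructor
  · intro hq
    ext q
    by_cases h0 : P.queryMarginal h n q = 0
    · rw [h0, hzero q h0]
    · have := hq q h0
      refine (ENNReal.mul_right_inj (hpos w) (PMF.apply_ne_top _ _)).1 ?_
      conv_rhs => rw [← this, ENNReal.div_mul_cancel h0 (PMF.apply_ne_top _ _)]
  · intro hq q h0
    rw [hq, ENNReal.mul_div_cancel_right h0 (PMF.apply_ne_top _ _)]

end LinearProtocol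

/-! ### Ranks modulo a set of messages -/

section Quotients

variable {F : Type u} [Field F] {K L : ℕ}

/-- The coefficient vectors that involve only the messages in `S`. -/
def messageSpan (F : Type u) [Field F] {K : ℕ} (L : ℕ) (S : Finset (Fin K)) :
    Submodule F (Coeffs F K L) :=
  Submodule.span F (Set.range fun x : S × Fin L => unitVec (x.1 : Fin K) x.2)

lemma finrank_messageSpan (S : Finset (Fin K)) :
    Module.finrank F (messageSpan F L S) = S.card * L := by
  classical
  unfold messageSpan
  rw [finrank_span_eq_card]
  · simp
  · rw [Fintype.linearIndependent_iff]
    rintro g hg ⟨k, l⟩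
    have h1 := congrFun (congrFun hg k) l
    rw [Finset.sum_apply, Finset.sum_apply, Finset.sum_eq_single (k, l)] at h1
    · simpa [unitVec] using h1
    · rintro ⟨k', l'⟩ - hne
      by_cases hk : k = k'
      · subst hk
        have hl : l ≠ l' := fun h => hne (by rw [h])
        simp [unitVec, hl]
      · have hk' : (k : Fin K) ≠ k' := fun h => hk (Subtype.ext h)
        simp [unitVec, hk']
    · simp

lemma messageSpan_mono {S T : Finset (Fin K)} (h : S ⊆ T) :
    messageSpan F L S ≤ messageSpan F L T := by
  refine Submodule.span_mono ?_
  rintro _ ⟨⟨k, l⟩, rfl⟩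
  exact ⟨⟨⟨k, h k.2⟩, l⟩, rfl⟩

lemma messageSpan_union_le (S T : Finset (Fin K)) :
    messageSpan F L (S ∪ T) ≤ messageSpan F L S ⊔ messageSpan F L T := by
  refine Submodule.span_le.2 ?_
  rintro _ ⟨⟨⟨k, hk⟩, l⟩, rfl⟩
  rcases Finset.mem_union.1 hk with h | h
  · exact Submodule.mem_sup_left (Submodule.subset_span ⟨⟨⟨k, h⟩, l⟩, rfl⟩)
  · exact Submodule.mem_sup_right (Submodule.subset_span ⟨⟨⟨k, h⟩, l⟩, rfl⟩)

/-- The dimension of `V` modulo the coefficient vectors of the messages in `S`. -/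
def rankModulo (S : Finset (Fin K)) (V : Submodule F (Coeffs F K L)) : ℕ :=
  Module.finrank F (V ⊔ messageSpan F L S : Submodule F (Coeffs F K L)) - S.card * L

/-- The subtraction in `rankModulo` never truncates. -/
lemma finrank_sup_messageSpan (S : Finset (Fin K)) (V : Submodule F (Coeffs F K L)) :
    Module.finrank F (V ⊔ messageSpan F L S : Submodule F (Coeffs F K L))
      = rankModulo S V + S.card * L := by
  have := Submodule.finrank_mono (le_sup_right : messageSpan F L S ≤ V ⊔ messageSpan F L S)
  rw [finrank_messageSpan] at this
  unfold rankModulo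
  omega

lemma rankModulo_empty_le (V : Submodule F (Coeffs F K L)) :
    rankModulo ∅ V ≤ Module.finrank F V := by
  have h1 := finrank_sup_messageSpan ∅ V
  have h2 := Submodule.finrank_add_le_finrank_add_finrank V (messageSpan F L ∅)
  rw [finrank_messageSpan] at h2
  simp only [Finset.card_empty, zero_mul, add_zero] at h1 h2
  omega

lemma rankModulo_mono (S : Finset (Fin K)) {V V' : Submodule F (Coeffs F K L)} (h : V ≤ V') :
    rankModulo S V ≤ rankModulo S V' :=
  Nat.sub_le_sub_right (Submodule.finrank_mono (sup_le_sup_right h _)) _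

lemma rankModulo_bot (S : Finset (Fin K)) :
    rankModulo S (⊥ : Submodule F (Coeffs F K L)) = 0 := by
  unfold rankModulo
  rw [bot_sup_eq, finrank_messageSpan, Nat.sub_self]

lemma rankModulo_sup_le (S : Finset (Fin K)) (V V' : Submodule F (Coeffs F K L)) :
    rankModulo S (V ⊔ V') ≤ rankModulo S V + rankModulo S V' := by
  have h := Submodule.finrank_sup_add_finrank_inf_eq
    (V ⊔ messageSpan F L S) (V' ⊔ messageSpan F L S)
  rw [← sup_sup_distrib_right] at h
  have h2 := Submodule.finrank_mono
    (le_inf le_sup_right le_sup_right :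
      messageSpan F L S ≤ (V ⊔ messageSpan F L S) ⊓ (V' ⊔ messageSpan F L S))
  rw [finrank_messageSpan] at h2
  simp only [finrank_sup_messageSpan] at h
  omega

lemma rankModulo_iSup_le {N : ℕ} (S : Finset (Fin K)) (V : Fin N → Submodule F (Coeffs F K L)) :
    rankModulo S (⨆ n, V n) ≤ ∑ n, rankModulo S (V n) := by
  classical
  have : ∀ A : Finset (Fin N), rankModulo S (A.sup V) ≤ ∑ n ∈ A, rankModulo S (V n) := by
    intro A
    induction A using Finset.induction_on with
    | empty => simp [rankModulo_bot]
    | insert a A ha ih =>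
      rw [Finset.sup_insert, Finset.sum_insert ha]
      exact (rankModulo_sup_le S _ _).trans (by omega)
  simpa [Finset.sup_univ_eq_iSup] using this Finset.univ

/-- As `V` already contains the messages in `W`, adjoining `S` or `S ∪ W` gives the same space; only
the subtracted dimension differs. -/
lemma rankModulo_of_le (S W : Finset (Fin K)) {V : Submodule F (Coeffs F K L)}
    (h : messageSpan F L W ≤ V) :
    rankModulo S V = (W \ S).card * L + rankModulo (S ∪ W) V := by
  have h1 : V ⊔ messageSpan F L S = V ⊔ messageSpan F L (S ∪ W) := by
    refine le_antisymm (sup_le_sup_left (messageSpan_mono Finset.subset_union_left) _)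
      (sup_le le_sup_left ((messageSpan_union_le S W).trans (sup_le le_sup_right ?_)))
    exact h.trans le_sup_left
  have h2 := finrank_sup_messageSpan S V
  rw [h1, finrank_sup_messageSpan] at h2
  have h3 : (S ∪ W).card = (W \ S).card + S.card := by
    rw [Finset.union_comm, ← Finset.sdiff_union_self_eq_union,
      Finset.card_union_of_disjoint Finset.sdiff_disjoint]
  rw [h3, add_mul] at h2
  omega

/-- One round of the converse for fixed queries: subadditivity over the servers modulo `S`, then
each server's rank modulo `S ∪ W` is at most that of the joint span. -/
lemma card_mul_rankModulo_le {N : ℕ} (S W : Finset (Fin K))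
    (V : Fin N → Submodule F (Coeffs F K L)) (h : messageSpan F L W ≤ ⨆ n, V n) :
    N * ((W \ S).card * L) + ∑ n, rankModulo (S ∪ W) (V n) ≤ N * ∑ n, rankModulo S (V n) := by
  have h1 := rankModulo_iSup_le S V
  rw [rankModulo_of_le S W h] at h1
  have h2 : ∑ n, rankModulo (S ∪ W) (V n) ≤ N * rankModulo (S ∪ W) (⨆ n, V n) := by
    refine (Finset.sum_le_card_nsmul _ _ _ fun n _ => rankModulo_mono _ (le_iSup V n)).trans ?_
    simp
  nlinarith [Nat.mul_le_mul_left N h1]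

end Quotients

/-! ### The converse bound -/

namespace LinearProtocol

variable {F : Type u} [Field F] {K D L N : ℕ}

/-- The expected total rank of the answers modulo the messages in `S`. -/
def expectedRankModulo (P : LinearProtocol F K D L N) (h : D ≤ K) (S : Finset (Fin K)) : ℝ≥0∞ :=
  ∑ n, ∑' q, P.queryMarginal h n q * (rankModulo S (listSpan (P.coeffs n q)) : ℝ≥0∞)

lemma expectedRankModulo_empty_le (P : LinearProtocol F K D L N) (h : D ≤ K) :
    P.expectedRankModulo h ∅ ≤ P.expectedRank h := by
  refine Finset.sum_le_sum fun n _ => ENNReal.tsum_le_tsum fun q => ?_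
  gcongr
  exact rankModulo_empty_le _

/-- Privacy enters the converse here: the expectation is a sum of terms in one query each, so it can
be computed under any fixed demand. -/
lemma expectedRankModulo_eq (P : LinearProtocol F K D L N) {h : D ≤ K} (hP : P.IsPrivate h)
    (S : Finset (Fin K)) (W : Demand K D) :
    P.expectedRankModulo h S
      = ∑' Q, P.queryLaw W Q * ((∑ n, rankModulo S (listSpan (P.coeffs n (Q n))) : ℕ) : ℝ≥0∞) := by
  unfold expectedRankModulo
  simp_rw [← (P.isPrivate_iff h).1 hP _ W, tsum_map_mul, Nat.cast_sum, Finset.mul_sum]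
  rw [Summable.tsum_finsetSum fun _ _ => ENNReal.summable]

lemma le_expectedRankModulo [Fintype F] (P : LinearProtocol F K D L N) {h : D ≤ K} {s : ℕ}
    (hs : 1 ≤ s) (hN : 1 ≤ N) (hP : P.IsPrivate h) (hR : P.IsRecoverable s) (S : Finset (Fin K))
    (W : Demand K D) :
    (((W.1 \ S).card * L : ℕ) : ℝ≥0∞) + P.expectedRankModulo h (S ∪ W.1) / N
      ≤ P.expectedRankModulo h S := by
  have hmem := (P.isRecoverable_iff hs).1 hR W
  have hN0 : (N : ℝ≥0∞) ≠ 0 := by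
    simp only [ne_eq, Nat.cast_eq_zero]
    omega
  have key : (N : ℝ≥0∞) * ((W.1 \ S).card * L : ℕ) + P.expectedRankModulo h (S ∪ W.1)
      ≤ N * P.expectedRankModulo h S := by
    rw [P.expectedRankModulo_eq hP _ W, P.expectedRankModulo_eq hP S W]
    have h1 : (N : ℝ≥0∞) * ((W.1 \ S).card * L : ℕ)
        = ∑' Q, P.queryLaw W Q * (N * ((W.1 \ S).card * L : ℕ)) := by
      rw [ENNReal.tsum_mul_right, PMF.tsum_coe, one_mul]
    rw [h1, ← ENNReal.tsum_add, ← ENNReal.tsum_mul_left]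
    refine ENNReal.tsum_le_tsum fun Q => ?_
    by_cases hQ : P.queryLaw W Q = 0
    · simp [hQ]
    have hle : messageSpan F L W.1 ≤ ⨆ n, listSpan (P.coeffs n (Q n)) := by
      refine Submodule.span_le.2 ?_
      rintro _ ⟨⟨⟨k, hk⟩, l⟩, rfl⟩
      have hr : k ∈ Set.range W.idx := by
        rw [Demand.idx, Finset.range_orderEmbOfFin]
        exact hk
      obtain ⟨c, rfl⟩ := hr
      exact hmem Q hQ c l
    have h2 := card_mul_rankModulo_le S W.1 (fun n => listSpan (P.coeffs n (Q n))) hle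
    rw [← mul_add, mul_left_comm]
    gcongr
    exact_mod_cast h2
  calc (((W.1 \ S).card * L : ℕ) : ℝ≥0∞) + P.expectedRankModulo h (S ∪ W.1) / N
      = ((N : ℝ≥0∞) * ((W.1 \ S).card * L : ℕ) + P.expectedRankModulo h (S ∪ W.1)) / N := by
        rw [ENNReal.add_div, mul_comm (N : ℝ≥0∞),
          ENNReal.mul_div_cancel_right hN0 (ENNReal.natCast_ne_top N)]
    _ ≤ P.expectedRankModulo h S := by
        refine ENNReal.div_le_of_le_mul ?_
        rwa [mul_comm (P.expectedRankModulo h S)]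

lemma geom_le_expectedRankModulo [Fintype F] (P : LinearProtocol F K D L N) {h : D ≤ K} {s : ℕ}
    (hs : 1 ≤ s) (hN : 1 ≤ N) (hP : P.IsPrivate h) (hR : P.IsRecoverable s) {r : ℕ} (hr : r < D)
    (f : ℕ) (S : Finset (Fin K)) (hS : Sᶜ.card = f * D + r) :
    ENNReal.ofReal (D * L * ∑ i ∈ Finset.range f, (1 / N : ℝ) ^ i + r * L * (1 / N : ℝ) ^ f)
      ≤ P.expectedRankModulo h S := by
  have hN0 : (0 : ℝ) < N := by exact_mod_cast hN
  induction f generalizing S with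
  | zero =>
    -- Fewer than `D` messages remain outside `S`. They are completed to a demand by messages of
    -- `S`, which contribute no new rank.
    obtain ⟨W, hSW, hW⟩ := Finset.exists_superset_card_eq (s := Sᶜ) (n := D) (by omega)
      (by simpa using h)
    have h1 : (W \ S).card = r := by
      rw [Finset.sdiff_eq_inter_compl, Finset.inter_eq_right.2 hSW]
      omega
    have h2 := P.le_expectedRankModulo hs hN hP hR S ⟨W, hW⟩
    simp only [h1] at h2
    refine le_trans ?_ (le_self_add.trans h2)
    rw [← ENNReal.ofReal_natCast]
    simp
  | succ f ih =>
    obtain ⟨W, hSW, hW⟩ := Finset.exists_subset_card_eq (s := Sᶜ) (n := D)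
      (by rw [hS, Nat.succ_mul]; omega)
    have h1 : W \ S = W := by
      rw [Finset.sdiff_eq_inter_compl, Finset.inter_eq_left.2 hSW]
    have h3 : (S ∪ W)ᶜ.card = f * D + r := by
      rw [Finset.compl_union, ← Finset.sdiff_eq_inter_compl, Finset.card_sdiff_of_subset hSW, hS,
        hW, Nat.succ_mul]
      omega
    have h2 := P.le_expectedRankModulo hs hN hP hR S ⟨W, hW⟩
    simp only [h1, hW] at h2
    refine le_trans ?_ (le_trans (add_le_add_right (ENNReal.div_le_div_right (ih _ h3) _) _) h2)
    rw [← ENNReal.ofReal_natCast, ← ENNReal.ofReal_natCast,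
      ← ENNReal.ofReal_div_of_pos hN0, ← ENNReal.ofReal_add (by positivity) (by positivity)]
    refine ENNReal.ofReal_le_ofReal (le_of_eq ?_)
    rw [Finset.sum_range_succ', pow_succ]
    simp_rw [pow_succ, ← Finset.sum_mul]
    push_cast
    ring

end LinearProtocol

lemma upperBound_eq {K D N : ℕ} (hD : 1 ≤ D) (hN : 2 ≤ N) :
    upperBound K D N = (∑ i ∈ Finset.range (K / D), (1 / N : ℝ) ^ i
      + ((K % D : ℕ) : ℝ) / D * (1 / N : ℝ) ^ (K / D))⁻¹ := by
  have hD0 : (D : ℝ) ≠ 0 := by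
    simp only [ne_eq, Nat.cast_eq_zero]
    omega
  have hN1 : (1 : ℝ) < N := by exact_mod_cast hN
  have h1 : (1 / N : ℝ) ≠ 1 := by
    rw [one_div]
    exact inv_ne_one.2 hN1.ne'
  have h2 : (K : ℝ) = D * ((K / D : ℕ) : ℝ) + ((K % D : ℕ) : ℝ) := by
    exact_mod_cast (Nat.div_add_mod K D).symm
  unfold upperBound
  rw [geom_sum_eq h1]
  congr 2
  · rw [one_div_pow, ← neg_div_neg_eq, neg_sub, neg_sub]
  · rw [one_div_pow]
    congr 1
    rw [h2]
    field_simp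
    ring

theorem capacity_le_upperBound {F : Type u} [Field F] [Fintype F] {K D L N s : ℕ}
    (hD : 1 ≤ D) (h : D ≤ K) (hL : 1 ≤ L) (hN : 2 ≤ N) (hs : 1 ≤ s) :
    capacity F L N s h ≤ ENNReal.ofReal (upperBound K D N) := by
  refine iSup_le fun P => iSup_le fun hP => iSup_le fun hR => ?_
  rw [P.rate_eq hs, upperBound_eq hD hN]
  have hr := Nat.mod_lt K hD
  have hlow := (P.geom_le_expectedRankModulo hs (by omega) hP hR hr (K / D) ∅
    (by simpa [mul_comm] using (Nat.div_add_mod K D).symm)).trans (P.expectedRankModulo_empty_le h)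
  set b : ℝ := ∑ i ∈ Finset.range (K / D), (1 / N : ℝ) ^ i
      + ((K % D : ℕ) : ℝ) / D * (1 / N : ℝ) ^ (K / D) with hb
  have hD0 : (0 : ℝ) < D := by exact_mod_cast hD
  have hL0 : (0 : ℝ) < L := by exact_mod_cast hL
  have hN0 : (0 : ℝ) < N := by
    have : 0 < N := by omega
    exact_mod_cast this
  have hbpos : 0 < b := by
    have h1 : 0 < ∑ i ∈ Finset.range (K / D), (1 / N : ℝ) ^ i := by
      refine Finset.sum_pos (fun i _ => by positivity) ?_
      exact Finset.nonempty_range_iff.2 (Nat.div_pos h hD).ne'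
    positivity
  have hc : (D * L * ∑ i ∈ Finset.range (K / D), (1 / N : ℝ) ^ i
      + ((K % D : ℕ) : ℝ) * L * (1 / N : ℝ) ^ (K / D)) = D * L * b := by
    rw [hb]
    field_simp
  rw [hc] at hlow
  have hDL : (D * L : ℝ≥0∞) = ENNReal.ofReal (D * L : ℝ) := by
    rw [ENNReal.ofReal_mul hD0.le, ENNReal.ofReal_natCast, ENNReal.ofReal_natCast]
  calc (D * L : ℝ≥0∞) / P.expectedRank h ≤ (D * L : ℝ≥0∞) / ENNReal.ofReal (D * L * b) :=
        ENNReal.div_le_div_left hlow _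
    _ = ENNReal.ofReal b⁻¹ := by
        rw [hDL, ← ENNReal.ofReal_div_of_pos (by positivity)]
        congr 1
        field_simp

/-! Vectors with a given support. -/

section Support

variable {F : Type u} [Field F]

/-- The support of a vector. -/
def support {n : ℕ} (x : Fin n → F) : Finset (Fin n) :=
  open Classical in Finset.univ.filter fun t => x t ≠ 0

lemma mem_support {n : ℕ} (x : Fin n → F) (t : Fin n) : t ∈ support x ↔ x t ≠ 0 := by
  simp [support]

lemma support_eq_iff {n : ℕ} (x : Fin n → F) (J : Finset (Fin n)) :
    support x = J ↔ ∀ t, x t ≠ 0 ↔ t ∈ J := by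
  simp [Finset.ext_iff, mem_support]

lemma support_eq_empty {n : ℕ} (x : Fin n → F) : support x = ∅ ↔ x = 0 := by
  simp [support_eq_iff, funext_iff]

variable [Fintype F]

/-- The vectors with support `J`. -/
def exactSupport (F : Type u) [Field F] [Fintype F] {n : ℕ} (J : Finset (Fin n)) :
    Finset (Fin n → F) :=
  open Classical in Finset.univ.filter fun x => support x = J

lemma mem_exactSupport {n : ℕ} (J : Finset (Fin n)) (x : Fin n → F) :
    x ∈ exactSupport F J ↔ support x = J := by
  simp [exactSupport]

lemma card_exactSupport {n : ℕ} (J : Finset (Fin n)) :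
    (exactSupport F J).card = (Fintype.card F - 1) ^ J.card := by
  classical
  have : exactSupport F J
      = Fintype.piFinset fun t => if t ∈ J then (Finset.univ.erase 0 : Finset F) else {0} := by
    ext x
    rw [mem_exactSupport, support_eq_iff, Fintype.mem_piFinset]
    refine forall_congr' fun t => ?_
    by_cases ht : t ∈ J <;> simp [ht]
  rw [this, Fintype.card_piFinset]
  have h2 : ∀ t, (if t ∈ J then (Finset.univ.erase 0 : Finset F) else {0}).card
      = if t ∈ J then Fintype.card F - 1 else 1 := by
    intro t
    split_ifs <;> simp
  simp_rw [h2]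
  rw [Finset.prod_ite_mem, Finset.univ_inter, Finset.prod_const]

lemma exactSupport_nonempty {n : ℕ} (J : Finset (Fin n)) : (exactSupport F J).Nonempty := by
  classical
  refine ⟨fun t => if t ∈ J then 1 else 0, ?_⟩
  rw [mem_exactSupport, support_eq_iff]
  simp

lemma mem_sparseVectors {n i : ℕ} (x : Fin n → F) :
    x ∈ sparseVectors F n i ↔ (support x).card = i := by
  simp [sparseVectors, support]

lemma card_sparseVectors (n i : ℕ) :
    (sparseVectors F n i).card = n.choose i * (Fintype.card F - 1) ^ i := by
  classical
  rw [Finset.card_eq_sum_card_fiberwise (f := support)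
    (t := Finset.powersetCard i Finset.univ)]
  · have : ∀ J ∈ Finset.powersetCard i (Finset.univ : Finset (Fin n)),
        ((sparseVectors F n i).filter fun x => support x = J).card
          = (Fintype.card F - 1) ^ i := by
      intro J hJ
      have hJ' := (Finset.mem_powersetCard.1 hJ).2
      have h2 : ((sparseVectors F n i).filter fun x => support x = J) = exactSupport F J := by
        ext x
        rw [Finset.mem_filter, mem_sparseVectors, mem_exactSupport]
        exact ⟨fun h => h.2, fun h => ⟨by rw [h, hJ'], h⟩⟩
      rw [h2, card_exactSupport, hJ']
    rw [Finset.sum_congr rfl this]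
    simp
  · intro x hx
    simpa [Finset.mem_powersetCard] using (mem_sparseVectors x).1 hx

lemma sparseVectors_nonempty {n i : ℕ} (h : i ≤ n) : (sparseVectors F n i).Nonempty := by
  obtain ⟨J, -, hJ⟩ := Finset.exists_subset_card_eq (s := (Finset.univ : Finset (Fin n)))
    (n := i) (by simpa using h)
  obtain ⟨x, hx⟩ := exactSupport_nonempty (F := F) J
  exact ⟨x, (mem_sparseVectors x).2 (by rw [(mem_exactSupport J x).1 hx, hJ])⟩

lemma uniformOn_sparseVectors_apply {n i : ℕ} (h : i ≤ n) (x a : Fin n → F) :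
    uniformOn (sparseVectors F n i) a x
      = if (support x).card = i then
          ((n.choose i * (Fintype.card F - 1) ^ i : ℕ) : ℝ≥0∞)⁻¹ else 0 := by
  split_ifs with hx
  · rw [uniformOn_apply_of_mem ((mem_sparseVectors x).2 hx), card_sparseVectors]
  · exact uniformOn_apply_of_notMem (sparseVectors_nonempty h)
      (fun h' => hx ((mem_sparseVectors x).1 h')) a

end Support

/-! The rows of the random matrix. -/

section Rows

variable {F : Type u} [Field F] [Fintype F] {D : ℕ}

/-- The circular shift of a set of positions. -/
def shift (J : Finset (Fin D)) (m : Fin D) : Finset (Fin D) := Finset.univ.filter fun c => c - m ∈ J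

lemma card_shift (J : Finset (Fin D)) (m : Fin D) : (shift J m).card = J.card := by
  have : NeZero D := ⟨(Fin.pos m).ne'⟩
  refine Finset.card_bij (fun c _ => c - m) (fun c hc => by simpa [shift] using hc)
    (fun a _ b _ h => by simpa using h) fun b hb => ⟨b + m, by simpa [shift] using hb, by simp⟩

lemma shift_injective (m : Fin D) : Function.Injective fun J : Finset (Fin D) => shift J m := by
  have : NeZero D := ⟨(Fin.pos m).ne'⟩
  intro J J' h
  ext c
  have := congrArg (fun S : Finset (Fin D) => c + m ∈ S) h
  simpa [shift] using this

lemma shift_surjective (m : Fin D) : Function.Surjective fun J : Finset (Fin D) => shift J m :=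
  Finite.surjective_of_injective (shift_injective m)

lemma mem_regularMatrices {J : Finset (Fin D)} {G : Matrix (Fin D) (Fin D) F} :
    G ∈ regularMatrices F J ↔ IsUnit G.det ∧ ∀ m, support (G m) = shift J m := by
  simp [regularMatrices, support_eq_iff, shift]

/-- Scaling columns by nonzero factors preserves invertibility and all supports, and moves any row
to any other row with the same support. -/
lemma regularMatrices_map_row {J : Finset (Fin D)} (hJ : (regularMatrices F J).Nonempty)
    (m : Fin D) :
    (uniformOn (regularMatrices F J) 1).map (fun G => G m)
      = uniformOn (exactSupport F (shift J m)) 0 := by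
  classical
  refine uniformOn_map hJ _ _ (fun G hG => ?_) (fun y hy y' hy' => ?_) _ _
  · exact (mem_exactSupport _ _).2 ((mem_regularMatrices.1 hG).2 m)
  · rw [mem_exactSupport] at hy hy'
    have hyy : ∀ c, y c = 0 ↔ y' c = 0 := fun c => by
      have h1 := mem_support y c
      have h2 := mem_support y' c
      rw [hy] at h1
      rw [hy', h1] at h2
      exact not_iff_not.1 h2
    set d : Fin D → F := fun c => if y c = 0 then 1 else y' c / y c with hd
    have hd0 : ∀ c, d c ≠ 0 := by
      intro c
      by_cases hc : y c = 0
      · simp [hd, hc]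
      · have := (hyy c).not.1 hc
        simp [hd, hc, this]
    refine ⟨fun G => G * Matrix.diagonal d, fun G G' h => ?_, fun G hG hy0 => ⟨?_, ?_⟩⟩
    · ext r c
      have := congrFun (congrFun h r) c
      simp only [Matrix.mul_diagonal] at this
      exact mul_right_cancel₀ (hd0 c) this
    · rw [mem_regularMatrices] at hG ⊢
      refine ⟨?_, fun r => ?_⟩
      · rw [Matrix.det_mul, Matrix.det_diagonal]
        exact hG.1.mul (isUnit_iff_ne_zero.2 (Finset.prod_ne_zero_iff.2 fun c _ => hd0 c))
      · rw [← hG.2 r]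
        ext c
        simp [mem_support, Matrix.mul_diagonal, hd0 c]
    · funext c
      have h0 : G m c = y c := congrFun hy0 c
      change (G * Matrix.diagonal d) m c = y' c
      rw [Matrix.mul_diagonal, h0]
      by_cases hc : y c = 0
      · simp [hc, (hyy c).1 hc]
      · simp [hd, hc, mul_div_cancel₀]

/-- The row of the scheme's matrix that occurs in the vector with a given label. -/
def labelRow {L : ℕ} (G : Matrix (Fin D) (Fin D) F) : Option (Fin L × Fin D) → Fin D → F
  | none => 0
  | some (_, m) => G m

/-- The law of the demand coefficients in the query to a server. -/
def rowLaw (F : Type u) [Field F] [Fintype F] (D L : ℕ) (j : Fin D) : PMF (Fin D → F) :=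
  (PMF.uniformOfFintype (Option (Fin L × Fin D))).bind fun o =>
    (uniformOn (Finset.powersetCard ((j : ℕ) + 1) (Finset.univ : Finset (Fin D))) ∅).bind fun J =>
      (uniformOn (regularMatrices F J) 1).map fun G => labelRow G o

/-- Every support pattern occurs. -/
def HasRegularMatrices (F : Type u) [Field F] [Fintype F] (D : ℕ) : Prop :=
  ∀ J : Finset (Fin D), J.Nonempty → (regularMatrices F J).Nonempty

lemma powersetCard_univ_nonempty (j : Fin D) :
    (Finset.powersetCard ((j : ℕ) + 1) (Finset.univ : Finset (Fin D))).Nonempty :=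
  Finset.powersetCard_nonempty.2 (by simp)

/-- The label is `none` with probability `1 / N`. Otherwise exactly one `J` shifts to the support of
`x`, and given `J` the row is uniform among the vectors with that support. -/
lemma rowLaw_apply (hreg : HasRegularMatrices F D) (L : ℕ) (j : Fin D) (x : Fin D → F) :
    rowLaw F D L j x
      = ((D * L + 1 : ℕ) : ℝ≥0∞)⁻¹ * ((if (support x).card = 0 then 1 else 0)
        + (D * L : ℕ) * (if (support x).card = j + 1 then
          ((D.choose (j + 1) * (Fintype.card F - 1) ^ ((j : ℕ) + 1) : ℕ) : ℝ≥0∞)⁻¹ else 0)) := by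
  classical
  have hnone : ((uniformOn (Finset.powersetCard ((j : ℕ) + 1) (Finset.univ : Finset (Fin D)))
      ∅).bind fun J => (uniformOn (regularMatrices F J) 1).map fun G =>
        labelRow (L := L) G none) x = if (support x).card = 0 then 1 else 0 := by
    have : ∀ J : Finset (Fin D), ((uniformOn (regularMatrices F J) 1).map fun G =>
        labelRow (L := L) G none) = PMF.pure 0 := fun J => PMF.map_const _ _
    simp_rw [this, PMF.bind_const, PMF.pure_apply, Finset.card_eq_zero, support_eq_empty]
    congr
  have hsome : ∀ y : Fin L × Fin D,
      ((uniformOn (Finset.powersetCard ((j : ℕ) + 1) (Finset.univ : Finset (Fin D)))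
      ∅).bind fun J => (uniformOn (regularMatrices F J) 1).map fun G => labelRow G (some y)) x
      = if (support x).card = j + 1 then
          ((D.choose (j + 1) * (Fintype.card F - 1) ^ ((j : ℕ) + 1) : ℕ) : ℝ≥0∞)⁻¹ else 0 := by
    rintro ⟨l, m⟩
    obtain ⟨J0, hJ0 : shift J0 m = support x⟩ := shift_surjective m (support x)
    have hcard : (support x).card = J0.card := by rw [← hJ0, card_shift]
    rw [PMF.bind_apply, tsum_eq_single J0]
    · by_cases hx : (support x).card = j + 1
      · have hmem : J0 ∈ Finset.powersetCard ((j : ℕ) + 1) (Finset.univ : Finset (Fin D)) := by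
          simp [Finset.mem_powersetCard, ← hcard, hx]
        have hne : J0.Nonempty := Finset.card_pos.1 (by omega)
        have hrow := regularMatrices_map_row (hreg J0 hne) m
        rw [if_pos hx, uniformOn_apply_of_mem hmem]
        change _ * ((uniformOn (regularMatrices F J0) 1).map fun G => G m) x = _
        rw [hrow, uniformOn_apply_of_mem ((mem_exactSupport _ _).2 hJ0.symm), card_exactSupport,
          hJ0, hx, Finset.card_powersetCard, Finset.card_univ, Fintype.card_fin, Nat.cast_mul,
          ENNReal.mul_inv (Or.inr (ENNReal.natCast_ne_top _)) (Or.inl (ENNReal.natCast_ne_top _))]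
      · rw [if_neg hx, uniformOn_apply_of_notMem (powersetCard_univ_nonempty j), zero_mul]
        simp [Finset.mem_powersetCard, ← hcard, hx]
    · intro J hJ
      by_cases hmem : J ∈ Finset.powersetCard ((j : ℕ) + 1) (Finset.univ : Finset (Fin D))
      · have hne : J.Nonempty := by
          rw [← Finset.card_pos, (Finset.mem_powersetCard.1 hmem).2]
          omega
        have hrow := regularMatrices_map_row (hreg J hne) m
        change _ * ((uniformOn (regularMatrices F J) 1).map fun G => G m) x = _
        rw [hrow, uniformOn_apply_of_notMem (exactSupport_nonempty _), mul_zero]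
        rw [mem_exactSupport, ← hJ0]
        exact fun h => hJ (shift_injective m h.symm)
      · rw [uniformOn_apply_of_notMem (powersetCard_univ_nonempty j) hmem, zero_mul]
  rw [rowLaw, PMF.bind_apply, tsum_fintype, Fintype.sum_option]
  simp_rw [hnone, hsome, PMF.uniformOfFintype_apply]
  rw [Finset.sum_const, nsmul_eq_mul, mul_add]
  simp [mul_comm, mul_left_comm]

end Rows

/-! The law of a single query. -/

section QueryLaw

variable {F : Type u} [Field F] {K D L : ℕ}

lemma Demand.mem_range_idx_or (W : Demand K D) (k : Fin K) :
    (∃ c, W.idx c = k) ∨ ∃ t, W.coIdx t = k := by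
  by_cases hk : k ∈ W.1
  · left
    have : k ∈ Set.range W.idx := by
      rw [Demand.idx, Finset.range_orderEmbOfFin]
      exact hk
    exact this
  · right
    have : k ∈ Set.range W.coIdx := by
      rw [Demand.coIdx, Finset.range_orderEmbOfFin]
      simpa using hk
    exact this

lemma Demand.idx_mem (W : Demand K D) (c : Fin D) : W.idx c ∈ W.1 :=
  Finset.orderEmbOfFin_mem _ _ _

lemma Demand.coIdx_notMem (W : Demand K D) (t : Fin (K - D)) : W.coIdx t ∉ W.1 :=
  Finset.mem_compl.1 (Finset.orderEmbOfFin_mem _ _ _)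

lemma Demand.coIdx_ne_idx (W : Demand K D) (t : Fin (K - D)) (c : Fin D) :
    W.coIdx t ≠ W.idx c := fun h => W.coIdx_notMem t (h ▸ W.idx_mem c)

/-- The coefficient of each message, given the interference and the demand coefficients. -/
def glue (W : Demand K D) (h : Fin (K - D) → F) (x : Fin D → F) : Fin K → F := fun k =>
  (∑ t, if W.coIdx t = k then h t else 0) + ∑ c, if W.idx c = k then x c else 0

lemma glue_idx (W : Demand K D) (h : Fin (K - D) → F) (x : Fin D → F) (c : Fin D) :
    glue W h x (W.idx c) = x c := by
  simp [glue, W.coIdx_ne_idx]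

lemma glue_coIdx (W : Demand K D) (h : Fin (K - D) → F) (x : Fin D → F) (t : Fin (K - D)) :
    glue W h x (W.coIdx t) = h t := by
  simp [glue, (W.coIdx_ne_idx _ _).symm]

lemma eq_glue_iff (W : Demand K D) (h : Fin (K - D) → F) (x : Fin D → F) (a : Fin K → F) :
    a = glue W h x ↔ h = a ∘ W.coIdx ∧ x = a ∘ W.idx := by
  constructor
  · rintro rfl
    exact ⟨funext fun t => (glue_coIdx W h x t).symm, funext fun c => (glue_idx W h x c).symm⟩
  · rintro ⟨rfl, rfl⟩
    funext k
    rcases W.mem_range_idx_or k with ⟨c, rfl⟩ | ⟨t, rfl⟩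
    · rw [glue_idx]; rfl
    · rw [glue_coIdx]; rfl

/-- The vector with one coefficient `a k` for each message `k`, at the subpacket `τ k`. -/
def placed (a : Fin K → F) (τ : Fin K → Fin L) : Coeffs F K L :=
  fun k r => if τ k = r then a k else 0

/-- The position, before reordering, of the subpacket of message `k` that occurs in the vector
with a given label. -/
def labelSlot (hL : 1 ≤ L) (W : Demand K D) : Option (Fin L × Fin D) → Fin K → Fin L
  | none => fun _ => ⟨0, hL⟩
  | some (l, _) => fun k => if k ∈ W.1 then l else ⟨0, hL⟩

lemma schemeVector_eq_placed (hL : 1 ≤ L) (W : Demand K D) (σ : Fin K → Equiv.Perm (Fin L))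
    (h : Fin (K - D) → F) (G : Matrix (Fin D) (Fin D) F) (o : Option (Fin L × Fin D)) :
    schemeVector W σ h G o
      = placed (glue W h (labelRow G o)) fun k => σ k (labelSlot hL W o k) := by
  have hσ : ∀ k r, (((σ k).symm r : Fin L) : ℕ) = 0 ↔ σ k ⟨0, hL⟩ = r := by
    intro k r
    rw [← Equiv.eq_symm_apply, Fin.ext_iff]
    exact eq_comm
  have hI : ∀ k r, interferencePart W σ h k r
      = ∑ t, if W.coIdx t = k then (if σ k ⟨0, hL⟩ = r then h t else 0) else 0 := by
    intro k r
    unfold interferencePart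
    simp_rw [hσ, ite_and]
  funext k r
  rcases o with _ | ⟨l, m⟩
  · change interferencePart W σ h k r = _
    rw [hI]
    rcases W.mem_range_idx_or k with ⟨c, rfl⟩ | ⟨t, rfl⟩
    · simp [W.coIdx_ne_idx, placed, glue_idx, labelRow]
    · simp [placed, glue_coIdx, labelSlot]
  · change interferencePart W σ h k r + demandPart W σ G l m k r = _
    rw [hI]
    unfold demandPart
    simp_rw [ite_and]
    rcases W.mem_range_idx_or k with ⟨c, rfl⟩ | ⟨t, rfl⟩
    · simp [W.coIdx_ne_idx, placed, glue_idx, labelRow, labelSlot, W.idx_mem]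
    · simp [placed, glue_coIdx, labelSlot, (W.coIdx_ne_idx _ _).symm, W.coIdx_notMem]

lemma uniformOfFintype_equiv_map {A B : Type*} [Fintype A] [Fintype B] [DecidableEq A]
    [DecidableEq B] [Nonempty (A ≃ B)] [Nonempty B] (a : A) :
    (PMF.uniformOfFintype (A ≃ B)).map (fun π => π a) = PMF.uniformOfFintype B := by
  refine uniformOfFintype_map _ fun y y' => ⟨fun π => π.trans (Equiv.swap y y'), ?_, ?_⟩
  · intro π π' h
    ext x
    simpa using congrArg (fun ρ : A ≃ B => Equiv.swap y y' (ρ x)) h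
  · rintro π rfl
    simp

lemma uniformOfFintype_perms_map [NeZero L] (ℓ : Fin K → Fin L) :
    (PMF.uniformOfFintype (Fin K → Equiv.Perm (Fin L))).map (fun σ k => σ k (ℓ k))
      = PMF.uniformOfFintype (Fin K → Fin L) := by
  refine uniformOfFintype_map _ fun y y' =>
    ⟨fun σ k => Equiv.swap (y k) (y' k) * σ k, ?_, ?_⟩
  · intro σ σ' h
    funext k
    exact mul_left_cancel (congrFun h k)
  · rintro σ rfl
    simp

variable [Fintype F]

/-- The law of the coefficients of the messages in the query to a server. -/
def coefficientLaw (F : Type u) [Field F] [Fintype F] (L : ℕ)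
    (p : PMF (Fin (K - D + 1) × Fin D)) (W : Demand K D) : PMF (Fin K → F) :=
  p.bind fun ij => (uniformOn (sparseVectors F (K - D) (ij.1 : ℕ)) 0).bind fun h =>
    (rowLaw F D L ij.2).map fun x => glue W h x

/-- A random bijection gives the server a uniform label, and for a fixed label the random orders
move the occupied slots to uniform positions. So the positions are independent of the coefficients
and carry no information on `W`. -/
lemma scheme_queryLaw_map (hL : 1 ≤ L) (p : PMF (Fin (K - D + 1) × Fin D)) (W : Demand K D)
    (n : Fin (D * L + 1)) :
    ((scheme p : LinearProtocol F K D L (D * L + 1)).queryLaw W).map (fun Q => Q n)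
      = (coefficientLaw F L p W).bind fun a =>
        haveI : NeZero L := ⟨by omega⟩
        (PMF.uniformOfFintype (Fin K → Fin L)).map (placed a) := by
  have : NeZero L := ⟨by omega⟩
  unfold coefficientLaw rowLaw scheme
  simp only [PMF.map_bind, PMF.bind_bind, PMF.map_comp, PMF.bind_map]
  congr 1
  funext ij
  congr 1
  funext h
  -- The scheme draws the label after `J` and `G`, while `rowLaw` draws it first; independent draws
  -- commute.
  rw [PMF.bind_comm (PMF.uniformOfFintype (Option (Fin L × Fin D)))]
  congr 1
  funext J
  rw [PMF.bind_comm (PMF.uniformOfFintype (Option (Fin L × Fin D)))]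
  congr 1
  funext G
  have h1 : ∀ σ : Fin K → Equiv.Perm (Fin L),
      PMF.map ((fun Q : Fin (D * L + 1) → Coeffs F K L => Q n) ∘
        fun π : Fin (D * L + 1) ≃ Option (Fin L × Fin D) => fun n => schemeVector W σ h G (π n))
        (PMF.uniformOfFintype (Fin (D * L + 1) ≃ Option (Fin L × Fin D)))
      = (PMF.uniformOfFintype (Option (Fin L × Fin D))).bind fun o =>
        PMF.pure (schemeVector W σ h G o) := by
    intro σ
    rw [← uniformOfFintype_equiv_map (B := Option (Fin L × Fin D)) n, PMF.bind_map]
    rfl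
  simp_rw [h1]
  rw [PMF.bind_comm]
  congr 1
  funext o
  simp only [Function.comp_apply]
  rw [← uniformOfFintype_perms_map (labelSlot hL W o), PMF.map_comp]
  simp_rw [schemeVector_eq_placed hL]
  rfl

lemma coefficientLaw_apply (p : PMF (Fin (K - D + 1) × Fin D)) (W : Demand K D) (a : Fin K → F)
    (i : Fin (K - D + 1)) (hi : (i : ℕ) = (support (a ∘ W.coIdx)).card) :
    coefficientLaw F L p W a
      = (((K - D).choose i * (Fintype.card F - 1) ^ (i : ℕ) : ℕ) : ℝ≥0∞)⁻¹
        * ∑ j, p (i, j) * rowLaw F D L j (a ∘ W.idx) := by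
  classical
  have h1 : ∀ ij : Fin (K - D + 1) × Fin D,
      ((uniformOn (sparseVectors F (K - D) (ij.1 : ℕ)) 0).bind fun h =>
        (rowLaw F D L ij.2).map fun x => glue W h x) a
      = uniformOn (sparseVectors F (K - D) (ij.1 : ℕ)) 0 (a ∘ W.coIdx)
        * rowLaw F D L ij.2 (a ∘ W.idx) := by
    intro ij
    rw [PMF.bind_apply, tsum_eq_single (a ∘ W.coIdx)]
    · congr 1
      rw [PMF.map_apply, tsum_eq_single (a ∘ W.idx)]
      · rw [if_pos ((eq_glue_iff _ _ _ _).2 ⟨rfl, rfl⟩)]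
      · intro x hx
        rw [if_neg fun h => hx ((eq_glue_iff _ _ _ _).1 h).2]
    · intro h hh
      rw [PMF.map_apply]
      simp only [eq_glue_iff]
      simp [hh]
  rw [coefficientLaw, PMF.bind_apply]
  simp_rw [h1]
  rw [tsum_fintype, Fintype.sum_prod_type]
  rw [Finset.sum_eq_single i, Finset.mul_sum]
  · refine Finset.sum_congr rfl fun j _ => ?_
    rw [uniformOn_sparseVectors_apply (by omega), if_pos hi.symm, mul_left_comm]
  · intro i' _ hne
    refine Finset.sum_eq_zero fun j _ => ?_
    rw [uniformOn_sparseVectors_apply (by omega), if_neg, zero_mul, mul_zero]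
    rw [← hi]
    exact fun h => hne (Fin.ext h.symm)
  · simp

end QueryLaw

/-! The numbers `P_{i,j}`. -/

section Numbers

variable (K D L : ℕ)

lemma beta_pos (hD : 1 ≤ D) (hL : 1 ≤ L) {j : ℕ} (hj : j ≤ D) : 0 < beta D L j := by
  have h1 : (0 : ℝ) < D := by exact_mod_cast hD
  have h2 : (0 : ℝ) < L := by exact_mod_cast hL
  have h3 : (0 : ℝ) < D.choose j := by exact_mod_cast Nat.choose_pos hj
  unfold beta
  positivity

lemma beta_nonneg (j : ℕ) : 0 ≤ beta D L j := by
  unfold beta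
  positivity

lemma matM_nonneg (i j : Fin D) : 0 ≤ matM D L i j := by
  have h1 := beta_nonneg D L 1
  have h2 := beta_nonneg D L i
  have h3 := beta_nonneg D L (i + 1)
  simp only [matM, Matrix.of_apply]
  split_ifs <;> positivity

lemma matM_pow_nonneg (m : ℕ) (i j : Fin D) : 0 ≤ (matM D L ^ m) i j := by
  induction m generalizing i j with
  | zero =>
    rw [pow_zero, Matrix.one_apply]
    split_ifs <;> norm_num
  | succ m ih =>
    rw [pow_succ, Matrix.mul_apply]
    exact Finset.sum_nonneg fun k _ => mul_nonneg (ih i k) (matM_nonneg D L k j)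

/-- The column sums of the powers of `M`. -/
def powSum (m : ℕ) (j : Fin D) : ℝ := ∑ i, (matM D L ^ m) i j

lemma powSum_nonneg (m : ℕ) (j : Fin D) : 0 ≤ powSum D L m j :=
  Finset.sum_nonneg fun i _ => matM_pow_nonneg D L m i j

lemma powSum_zero (j : Fin D) : powSum D L 0 j = 1 := by
  simp [powSum, Matrix.one_apply]

lemma vecF_eq (j : Fin D) : vecF K D L j = powSum D L (K - D) j := by
  simp [vecF, powSum, Matrix.vecMul, dotProduct]

lemma vecG_eq (j : Fin D) :
    vecG K D L j
      = ∑ m ∈ Finset.range (K - D + 1), ((K - D).choose m : ℝ) * powSum D L m j := by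
  have h : (1 + matM D L) ^ (K - D) = ∑ m ∈ Finset.range (K - D + 1),
      ((K - D).choose m : ℝ) • matM D L ^ m := by
    rw [add_comm, (Commute.one_right (matM D L)).add_pow]
    refine Finset.sum_congr rfl fun m _ => ?_
    rw [one_pow, mul_one, ← nsmul_eq_mul', Nat.cast_smul_eq_nsmul]
  simp only [vecG, h, Matrix.vecMul, dotProduct, one_mul, powSum, Finset.mul_sum]
  rw [Finset.sum_comm]
  refine Finset.sum_congr rfl fun i _ => ?_
  simp [Matrix.sum_apply]

lemma one_le_vecG (j : Fin D) : 1 ≤ vecG K D L j := by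
  rw [vecG_eq, Finset.sum_range_succ', powSum_zero]
  have : 0 ≤ ∑ m ∈ Finset.range (K - D), ((K - D).choose (m + 1) : ℝ) * powSum D L (m + 1) j :=
    Finset.sum_nonneg fun m _ => mul_nonneg (Nat.cast_nonneg _) (powSum_nonneg D L _ j)
  simpa using this

lemma vecF_le_vecG (j : Fin D) : vecF K D L j ≤ vecG K D L j := by
  rw [vecG_eq, Finset.sum_range_succ, vecF_eq]
  have : 0 ≤ ∑ m ∈ Finset.range (K - D), ((K - D).choose m : ℝ) * powSum D L m j :=
    Finset.sum_nonneg fun m _ => mul_nonneg (Nat.cast_nonneg _) (powSum_nonneg D L _ j)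
  simpa using this

lemma ratio_nonneg (j : Fin D) : 0 ≤ vecF K D L j / vecG K D L j := by
  refine div_nonneg ?_ (zero_le_one.trans (one_le_vecG K D L j))
  rw [vecF_eq]
  exact powSum_nonneg D L _ j

lemma ratio_le_one (j : Fin D) : vecF K D L j / vecG K D L j ≤ 1 :=
  (div_le_one (zero_lt_one.trans_le (one_le_vecG K D L j))).2 (vecF_le_vecG K D L j)

variable (jstar : Fin D)

/-- The vectors `M ^ (K - D - i) P_{K-D}`. -/
def backward (i : ℕ) : Fin D → ℝ :=
  (matM D L ^ (K - D - i)).mulVec (Pi.single jstar (1 / vecG K D L jstar))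

lemma pairProb_eq (i : Fin (K - D + 1)) (j : Fin D) :
    pairProb K D L jstar i j = ((K - D).choose i : ℝ) * backward K D L jstar i j := rfl

lemma backward_apply (i : ℕ) (j : Fin D) :
    backward K D L jstar i j = (matM D L ^ (K - D - i)) j jstar / vecG K D L jstar := by
  simp [backward, div_eq_mul_inv]

lemma backward_nonneg (i : ℕ) (j : Fin D) : 0 ≤ backward K D L jstar i j := by
  rw [backward_apply]
  exact div_nonneg (matM_pow_nonneg D L _ _ _) (zero_le_one.trans (one_le_vecG K D L jstar))

lemma pairProb_nonneg (i : Fin (K - D + 1)) (j : Fin D) : 0 ≤ pairProb K D L jstar i j :=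
  mul_nonneg (Nat.cast_nonneg _) (backward_nonneg K D L jstar i j)

lemma sum_backward (i : ℕ) :
    ∑ j, backward K D L jstar i j = powSum D L (K - D - i) jstar / vecG K D L jstar := by
  simp_rw [backward_apply, powSum, Finset.sum_div]

/-- By the binomial theorem the total is the `j*` entry of `1ᵀ (1 + M) ^ (K - D)` divided by
`g_{j*}`, which explains the normalization. -/
lemma sum_pairProb : ∑ i, ∑ j, pairProb K D L jstar i j = 1 := by
  simp_rw [pairProb_eq, ← Finset.mul_sum, sum_backward]
  rw [Fin.sum_univ_eq_sum_range fun i =>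
    ((K - D).choose i : ℝ) * (powSum D L (K - D - i) jstar / vecG K D L jstar)]
  simp_rw [mul_div_assoc', ← Finset.sum_div]
  rw [div_eq_one_iff_eq (zero_lt_one.trans_le (one_le_vecG K D L jstar)).ne', vecG_eq,
    ← Finset.sum_range_reflect]
  refine Finset.sum_congr rfl fun m hm => ?_
  have hm' : m ≤ K - D := Nat.lt_succ_iff.1 (Finset.mem_range.1 hm)
  rw [Nat.add_sub_cancel, Nat.choose_symm hm', Nat.sub_sub_self hm']

/-- The law of the pair `(i, j)`. -/
def pairLaw : PMF (Fin (K - D + 1) × Fin D) :=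
  PMF.ofFintype (fun ij => ENNReal.ofReal (pairProb K D L jstar ij.1 ij.2)) (by
    rw [← ENNReal.ofReal_sum_of_nonneg fun ij _ => pairProb_nonneg K D L jstar ij.1 ij.2,
      Fintype.sum_prod_type, sum_pairProb, ENNReal.ofReal_one])

lemma backward_step {i : ℕ} (hi : i + 1 ≤ K - D) :
    backward K D L jstar i = (matM D L).mulVec (backward K D L jstar (i + 1)) := by
  unfold backward
  rw [Matrix.mulVec_mulVec, ← pow_succ']
  congr 2
  omega

/-- The scaled probability that a query involves given `i` interference messages and given `j`
demanded messages. -/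
def level (i j : ℕ) : ℝ :=
  if h : 1 ≤ j ∧ j ≤ D then beta D L j * backward K D L jstar i ⟨j - 1, by omega⟩
  else ∑ c, backward K D L jstar i c

/-- This recursion dictates the form of `M`: the constant first row gives the case `j = 0`, where
`level` is a sum over all entries, and the subdiagonal gives `j ≥ 1`. -/
lemma level_step (hL : 1 ≤ L) {i j : ℕ} (hi : i + 1 ≤ K - D) (hj : j + 1 ≤ D) :
    level K D L jstar i (j + 1) = level K D L jstar (i + 1) j := by
  have hb := (beta_pos D L (by omega) hL hj).ne'
  rw [level, dif_pos ⟨by omega, hj⟩, backward_step K D L jstar hi, Matrix.mulVec, dotProduct]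
  rcases j with _ | j
  · have h1 : ∀ c : Fin D, matM D L ⟨0 + 1 - 1, by omega⟩ c = 1 / beta D L 1 := fun c => by
      simp [matM]
    simp_rw [h1]
    rw [level, dif_neg (by omega), ← Finset.mul_sum]
    field_simp
  · rw [level, dif_pos ⟨by omega, by omega⟩,
      Finset.sum_eq_single ⟨j + 1 - 1, by omega⟩]
    · have h1 : matM D L ⟨j + 1 + 1 - 1, by omega⟩ ⟨j + 1 - 1, by omega⟩
          = beta D L (j + 1) / beta D L (j + 1 + 1) := by
        simp [matM]
      rw [h1]
      field_simp
    · intro c _ hc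
      have h1 : matM D L ⟨j + 1 + 1 - 1, by omega⟩ c = 0 := by
        have : (c : ℕ) ≠ j := fun h => hc (Fin.ext (by simpa using h))
        simp [matM, this]
      rw [h1, zero_mul]
    · simp

lemma level_add (hL : 1 ≤ L) {i j d : ℕ} (hi : i + d ≤ K - D) (hj : j + d ≤ D) :
    level K D L jstar i (j + d) = level K D L jstar (i + d) j := by
  induction d generalizing i with
  | zero => rfl
  | succ d ih =>
    rw [← add_assoc, level_step K D L jstar hL (by omega) (by omega), ih (by omega) (by omega)]
    congr 1
    omega

lemma level_congr (hL : 1 ≤ L) {i j i' j' : ℕ} (hi : i ≤ K - D) (hi' : i' ≤ K - D) (hj : j ≤ D)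
    (hj' : j' ≤ D) (h : i + j = i' + j') : level K D L jstar i j = level K D L jstar i' j' := by
  rcases le_total i i' with hle | hle
  · obtain ⟨d, rfl⟩ := Nat.exists_eq_add_of_le hle
    obtain rfl : j = j' + d := by omega
    exact level_add K D L jstar hL hi' hj
  · obtain ⟨d, rfl⟩ := Nat.exists_eq_add_of_le hle
    obtain rfl : j' = j + d := by omega
    exact (level_add K D L jstar hL hi hj').symm

end Numbers

/-! Privacy of the scheme. -/

section Privacy

variable {F : Type u} [Field F] [Fintype F] {K D L : ℕ}

lemma inv_natCast_eq_ofReal {n : ℕ} (hn : 0 < n) : (n : ℝ≥0∞)⁻¹ = ENNReal.ofReal (n : ℝ)⁻¹ := by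
  rw [ENNReal.ofReal_inv_of_pos (by exact_mod_cast hn), ENNReal.ofReal_natCast]

lemma rowLaw_apply_eq_ofReal (hreg : HasRegularMatrices F D) (L : ℕ) (j : Fin D) (x : Fin D → F) :
    rowLaw F D L j x
      = ENNReal.ofReal (((D * L + 1 : ℕ) : ℝ)⁻¹ * ((if (support x).card = 0 then 1 else 0)
        + (D * L : ℕ) * (if (support x).card = j + 1 then
          ((D.choose (j + 1) * (Fintype.card F - 1) ^ ((j : ℕ) + 1) : ℕ) : ℝ)⁻¹ else 0))) := by
  have hq : 0 < Fintype.card F - 1 := Nat.sub_pos_of_lt Fintype.one_lt_card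
  have hc : 0 < D.choose (j + 1) * (Fintype.card F - 1) ^ ((j : ℕ) + 1) :=
    Nat.mul_pos (Nat.choose_pos (by omega)) (pow_pos hq _)
  have h0 : (0 : ℝ) ≤ ((D.choose (j + 1) * (Fintype.card F - 1) ^ ((j : ℕ) + 1) : ℕ) : ℝ)⁻¹ :=
    inv_nonneg.2 (Nat.cast_nonneg _)
  rw [rowLaw_apply hreg, ENNReal.ofReal_mul (inv_nonneg.2 (Nat.cast_nonneg _)),
    ← inv_natCast_eq_ofReal (Nat.succ_pos _), ENNReal.ofReal_add, ENNReal.ofReal_mul,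
    ENNReal.ofReal_natCast]
  · congr 3
    · split_ifs <;> simp
    · split_ifs
      · rw [inv_natCast_eq_ofReal hc]
      · simp
  · exact Nat.cast_nonneg _
  · split_ifs <;> norm_num
  · split_ifs
    · exact mul_nonneg (Nat.cast_nonneg _) h0
    · simp

lemma card_support_comp {F : Type u} [Field F] (W : Demand K D) (a : Fin K → F) :
    (support (a ∘ W.coIdx)).card + (support (a ∘ W.idx)).card = (support a).card := by
  classical
  have h : support a = (support (a ∘ W.coIdx)).map W.coIdx.toEmbedding
      ∪ (support (a ∘ W.idx)).map W.idx.toEmbedding := by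
    ext k
    simp only [Finset.mem_union, Finset.mem_map, mem_support, Function.comp_apply,
      RelEmbedding.coe_toEmbedding]
    constructor
    · intro hk
      rcases W.mem_range_idx_or k with ⟨c, rfl⟩ | ⟨t, rfl⟩
      · exact Or.inr ⟨c, hk, rfl⟩
      · exact Or.inl ⟨t, hk, rfl⟩
    · rintro (⟨t, ht, rfl⟩ | ⟨c, hc, rfl⟩) <;> assumption
  rw [h, Finset.card_union_of_disjoint, Finset.card_map, Finset.card_map]
  rw [Finset.disjoint_left]
  intro k hk hk'
  obtain ⟨t, -, rfl⟩ := Finset.mem_map.1 hk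
  obtain ⟨c, -, hc⟩ := Finset.mem_map.1 hk'
  exact W.coIdx_ne_idx t c hc.symm

lemma card_support_le {F : Type u} [Field F] {n : ℕ} (x : Fin n → F) : (support x).card ≤ n := by
  simpa using Finset.card_le_univ (support x)

/-- The factor `(K - D).choose i` in `pairProb` cancels the number of interference supports. For `k
≥ 1`, `beta` combines the `D * L` labels that carry a row with the `D.choose k` demand supports. -/
lemma coefficientLaw_eq_level (hL : 1 ≤ L) (hreg : HasRegularMatrices F D) {jstar : Fin D}
    {p : PMF (Fin (K - D + 1) × Fin D)}
    (hp : ∀ i j, p (i, j) = ENNReal.ofReal (pairProb K D L jstar i j)) (W : Demand K D)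
    (a : Fin K → F) :
    coefficientLaw F L p W a = ENNReal.ofReal
      (level K D L jstar (support (a ∘ W.coIdx)).card (support (a ∘ W.idx)).card
        / ((D * L + 1 : ℕ) * ((Fintype.card F - 1 : ℕ) : ℝ) ^ (support a).card)) := by
  have hq : 0 < Fintype.card F - 1 := Nat.sub_pos_of_lt Fintype.one_lt_card
  have hq' : (0 : ℝ) < ((Fintype.card F - 1 : ℕ) : ℝ) := by exact_mod_cast hq
  set i := (support (a ∘ W.coIdx)).card with hi
  set k := (support (a ∘ W.idx)).card with hk
  have hik : (support a).card = i + k := (card_support_comp W a).symm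
  have hile : i ≤ K - D := card_support_le _
  have hkle : k ≤ D := card_support_le _
  have hc : 0 < (K - D).choose i * (Fintype.card F - 1) ^ i :=
    Nat.mul_pos (Nat.choose_pos hile) (pow_pos hq _)
  have hch : ((K - D).choose i : ℝ) ≠ 0 := by exact_mod_cast (Nat.choose_pos hile).ne'
  rw [coefficientLaw_apply p W a ⟨i, by omega⟩ rfl]
  simp_rw [hp, rowLaw_apply_eq_ofReal hreg, ← hk]
  rw [inv_natCast_eq_ofReal hc]
  have hnn : ∀ j : Fin D, 0 ≤ ((D * L + 1 : ℕ) : ℝ)⁻¹ * ((if k = 0 then 1 else 0)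
        + (D * L : ℕ) * (if k = j + 1 then
          ((D.choose (j + 1) * (Fintype.card F - 1) ^ ((j : ℕ) + 1) : ℕ) : ℝ)⁻¹ else 0)) := by
    intro j
    have h1 : (0 : ℝ) ≤ if k = 0 then 1 else 0 := by split_ifs <;> norm_num
    have h2 : (0 : ℝ) ≤ if k = j + 1 then
        ((D.choose (j + 1) * (Fintype.card F - 1) ^ ((j : ℕ) + 1) : ℕ) : ℝ)⁻¹ else 0 := by
      split_ifs
      · exact inv_nonneg.2 (Nat.cast_nonneg _)
      · exact le_rfl
    positivity
  simp_rw [← ENNReal.ofReal_mul (pairProb_nonneg K D L jstar _ _)]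
  rw [← ENNReal.ofReal_sum_of_nonneg fun j _ =>
      mul_nonneg (pairProb_nonneg K D L jstar _ j) (hnn j),
    ← ENNReal.ofReal_mul (inv_nonneg.2 (Nat.cast_nonneg _))]
  congr 1
  simp_rw [pairProb_eq]
  rw [hik]
  have hN : ((D * L + 1 : ℕ) : ℝ) ≠ 0 := by exact_mod_cast Nat.succ_ne_zero (D * L)
  -- For `k = 0` only the label `none` contributes, for every `j`; for `k > 0` only the index `k -
  -- 1`, which stands for row supports of size `k`.
  rcases Nat.eq_zero_or_pos k with hk0 | hk0
  · have h1 : ∀ j : Fin D, (if k = (j : ℕ) + 1 then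
        ((D.choose (j + 1) * (Fintype.card F - 1) ^ ((j : ℕ) + 1) : ℕ) : ℝ)⁻¹ else 0) = 0 :=
      fun j => if_neg (by omega)
    simp_rw [h1, if_pos hk0, level]
    rw [dif_neg (by omega), ← Finset.sum_mul, ← Finset.mul_sum, hk0]
    push_cast
    field_simp
    simp [mul_comm]
  · rw [Finset.sum_eq_single ⟨k - 1, by omega⟩]
    · rw [level, dif_pos ⟨hk0, hkle⟩, if_neg (by omega), if_pos (by simp; omega)]
      have h2 : k - 1 + 1 = k := by omega
      have hDk : (D.choose k : ℝ) ≠ 0 := by exact_mod_cast (Nat.choose_pos hkle).ne'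
      simp only [h2, beta]
      push_cast
      push_cast at hq' hN
      field_simp
      ring
    · intro j _ hj
      have h3 : k ≠ (j : ℕ) + 1 := fun h => hj (Fin.ext (by simp; omega))
      rw [if_neg (by omega), if_neg h3]
      simp
    · simp

/-- The law of a query does not depend on the demand. -/
lemma coefficientLaw_congr (hL : 1 ≤ L) (hreg : HasRegularMatrices F D) {jstar : Fin D}
    {p : PMF (Fin (K - D + 1) × Fin D)}
    (hp : ∀ i j, p (i, j) = ENNReal.ofReal (pairProb K D L jstar i j)) (W W' : Demand K D) :
    coefficientLaw F L p W = coefficientLaw F L p W' := by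
  ext a
  rw [coefficientLaw_eq_level hL hreg hp, coefficientLaw_eq_level hL hreg hp,
    level_congr K D L jstar hL (card_support_le _) (card_support_le _) (card_support_le _)
      (card_support_le _) ((card_support_comp W a).trans (card_support_comp W' a).symm)]

lemma scheme_queryMarginal (hL : 1 ≤ L) (hreg : HasRegularMatrices F D) {jstar : Fin D}
    {p : PMF (Fin (K - D + 1) × Fin D)}
    (hp : ∀ i j, p (i, j) = ENNReal.ofReal (pairProb K D L jstar i j)) (h : D ≤ K)
    (n : Fin (D * L + 1)) (W : Demand K D) :
    ((scheme p : LinearProtocol F K D L (D * L + 1)).queryLaw W).map (fun Q => Q n)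
      = (scheme p : LinearProtocol F K D L (D * L + 1)).queryMarginal h n := by
  unfold LinearProtocol.queryMarginal
  have : ∀ W', ((scheme p : LinearProtocol F K D L (D * L + 1)).queryLaw W').map (fun Q => Q n)
      = ((scheme p : LinearProtocol F K D L (D * L + 1)).queryLaw W).map (fun Q => Q n) := by
    intro W'
    rw [scheme_queryLaw_map hL, scheme_queryLaw_map hL, coefficientLaw_congr hL hreg hp W' W]
  simp_rw [this, PMF.bind_const]

lemma scheme_isPrivate (hL : 1 ≤ L) (hreg : HasRegularMatrices F D) {jstar : Fin D}
    {p : PMF (Fin (K - D + 1) × Fin D)}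
    (hp : ∀ i j, p (i, j) = ENNReal.ofReal (pairProb K D L jstar i j)) (h : D ≤ K) :
    (scheme p : LinearProtocol F K D L (D * L + 1)).IsPrivate h :=
  (LinearProtocol.isPrivate_iff _ h).2 (scheme_queryMarginal hL hreg hp h)

end Privacy

/-! Invertible matrices with given support. -/

/-- Induction on the size: the determinant is affine in the corner entry, with slope the nonzero
minor. The entry must avoid zero and one further value, so three field elements suffice. -/
lemma exists_det_ne_zero_of_support {F : Type u} [Field F] [Fintype F] (hF : 3 ≤ Fintype.card F)
    (n : ℕ) (S : Fin n → Fin n → Prop) (hS : ∀ i, S i i) :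
    ∃ A : Matrix (Fin n) (Fin n) F, A.det ≠ 0 ∧ ∀ i j, A i j ≠ 0 ↔ S i j := by
  classical
  induction n with
  | zero => exact ⟨1, by simp, fun i => i.elim0⟩
  | succ n ih =>
    obtain ⟨B, hB, hBS⟩ := ih (fun i j => S i.succ j.succ) fun i => hS _
    let row : Fin n → F := fun j => if S 0 j.succ then 1 else 0
    let low : Fin n → Fin (n + 1) → F := fun i =>
      Fin.cons (if S i.succ 0 then 1 else 0) (B i)
    let A : F → Matrix (Fin (n + 1)) (Fin (n + 1)) F := fun d =>
      Matrix.of (Fin.cons (Fin.cons d row) low)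
    have hdet : ∀ d, (A d).det = d * B.det + (A 0).det := by
      intro d
      rw [Matrix.det_succ_row_zero, Matrix.det_succ_row_zero (A 0), Fin.sum_univ_succ,
        Fin.sum_univ_succ]
      have hsub : ∀ d, (A d).submatrix Fin.succ (Fin.succAbove 0) = B := by
        intro d
        ext i j
        simp [A, low]
      rw [hsub, hsub]
      simp only [A, Matrix.of_apply, Fin.cons_zero, Fin.cons_succ]
      simp
      rfl
    obtain ⟨d, hd⟩ : ∃ d : F, d ∉ ({0, -(A 0).det / B.det} : Finset F) := by
      by_contra! hall
      have h1 : (Finset.univ : Finset F) ⊆ {0, -(A 0).det / B.det} := fun d _ => hall d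
      have h2 := (Finset.card_le_card h1).trans Finset.card_le_two
      rw [Finset.card_univ] at h2
      omega
    simp only [Finset.mem_insert, Finset.mem_singleton, not_or] at hd
    refine ⟨A d, fun h0 => hd.2 ?_, fun i j => ?_⟩
    · rw [hdet] at h0
      rw [eq_div_iff hB]
      exact eq_neg_of_add_eq_zero_left h0
    · refine Fin.cases ?_ (fun i => ?_) i <;> refine Fin.cases ?_ (fun j => ?_) j
      · simp [A, hd.1, hS 0]
      · simp [A, row]
      · simp [A, low]
      · simp [A, low, ← hBS]

lemma hasRegularMatrices {F : Type u} [Field F] [Fintype F] (hF : 3 ≤ Fintype.card F) (D : ℕ) :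
    HasRegularMatrices F D := by
  rintro J ⟨j0, hj0⟩
  have : NeZero D := ⟨(Fin.pos j0).ne'⟩
  -- Moving the columns by `j0 ∈ J` puts the pattern on the diagonal; the column permutation is
  -- undone afterwards and changes the determinant only by a sign.
  obtain ⟨A, hA, hAS⟩ := exists_det_ne_zero_of_support hF D (fun m c => c + j0 - m ∈ J)
    fun m => by simpa using hj0
  refine ⟨A.submatrix id (Equiv.subRight j0), mem_regularMatrices.2 ⟨?_, fun m => ?_⟩⟩
  · rw [Matrix.det_permute', isUnit_iff_ne_zero]
    refine mul_ne_zero ?_ hA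
    rcases Int.units_eq_one_or (Equiv.Perm.sign (Equiv.subRight j0)) with h | h <;> simp [h]
  · rw [support_eq_iff]
    intro c
    simp [hAS, shift]

/-! Recoverability and rate of the scheme. -/

section Rate

variable {F : Type u} [Field F] [Fintype F] {K D L : ℕ}

lemma demandPart_eq_sum {F : Type u} [Field F] (W : Demand K D) (σ : Fin K → Equiv.Perm (Fin L))
    (G : Matrix (Fin D) (Fin D) F) (l : Fin L) (m : Fin D) :
    demandPart W σ G l m = ∑ c, G m c • unitVec (W.idx c) (σ (W.idx c) l) := by
  funext k r
  rw [Finset.sum_apply, Finset.sum_apply]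
  refine Finset.sum_congr rfl fun c _ => ?_
  by_cases hk : W.idx c = k
  · subst hk
    simp [unitVec, Pi.single_apply, eq_comm]
  · simp [unitVec, hk, Ne.symm hk]

lemma eq_or_mem_of_mem_support_uniformOn {α : Type*} {S : Finset α} {a x : α}
    (h : x ∈ (uniformOn S a).support) : x = a ∨ x ∈ S := by
  rcases S.eq_empty_or_nonempty with rfl | hS
  · left
    simpa [uniformOn] using h
  · right
    by_contra hx
    exact h (uniformOn_apply_of_notMem hS hx a)

lemma exists_of_scheme_queryLaw_ne_zero {p : PMF (Fin (K - D + 1) × Fin D)} {W : Demand K D}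
    {Q : Fin (D * L + 1) → Coeffs F K L}
    (hQ : (scheme p : LinearProtocol F K D L (D * L + 1)).queryLaw W Q ≠ 0) :
    ∃ (h : Fin (K - D) → F) (G : Matrix (Fin D) (Fin D) F) (σ : Fin K → Equiv.Perm (Fin L))
      (π : Fin (D * L + 1) ≃ Option (Fin L × Fin D)),
      IsUnit G.det ∧ Q = fun n => schemeVector W σ h G (π n) := by
  replace hQ := (PMF.mem_support_iff _ _).2 hQ
  obtain ⟨ij, -, hQ⟩ := (PMF.mem_support_bind_iff _ _ _).1 hQ
  obtain ⟨h, -, hQ⟩ := (PMF.mem_support_bind_iff _ _ _).1 hQ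
  obtain ⟨J, -, hQ⟩ := (PMF.mem_support_bind_iff _ _ _).1 hQ
  obtain ⟨G, hG, hQ⟩ := (PMF.mem_support_bind_iff _ _ _).1 hQ
  obtain ⟨σ, -, hQ⟩ := (PMF.mem_support_bind_iff _ _ _).1 hQ
  obtain ⟨π, -, rfl⟩ := (PMF.mem_support_map_iff _ _ _).1 hQ
  refine ⟨h, G, σ, π, ?_, rfl⟩
  -- The default value of `uniformOn` is here the identity matrix, so invertibility holds even if no
  -- matrix has the required supports.
  rcases eq_or_mem_of_mem_support_uniformOn hG with rfl | hG
  · simp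
  · exact (mem_regularMatrices.1 hG).1

lemma scheme_isRecoverable (p : PMF (Fin (K - D + 1) × Fin D)) {s : ℕ} (hs : 1 ≤ s) :
    (scheme p : LinearProtocol F K D L (D * L + 1)).IsRecoverable s := by
  rw [LinearProtocol.isRecoverable_iff _ hs]
  intro W Q hQ c l
  obtain ⟨h, G, σ, π, hG, rfl⟩ := exists_of_scheme_queryLaw_ne_zero hQ
  set V := ⨆ n, listSpan ((scheme p : LinearProtocol F K D L (D * L + 1)).coeffs n
    (schemeVector W σ h G (π n))) with hV
  have hmem : ∀ o, schemeVector W σ h G o ∈ V := by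
    intro o
    refine Submodule.mem_iSup_of_mem (π.symm o) (Submodule.subset_span ?_)
    simp [scheme]
  have hdem : ∀ l m, demandPart W σ G l m ∈ V := by
    intro l m
    have := V.sub_mem (hmem (some (l, m))) (hmem none)
    simpa [schemeVector] using this
  -- After reordering, subpacket `l` of this message lies in block `σ⁻¹ l`; row `c` of `G⁻¹`
  -- isolates it there.
  have hsum : ∑ m, G⁻¹ c m • demandPart W σ G ((σ (W.idx c)).symm l) m = unitVec (W.idx c) l := by
    simp_rw [demandPart_eq_sum, Finset.smul_sum, smul_smul]
    rw [Finset.sum_comm]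
    simp_rw [← Finset.sum_smul, ← Matrix.mul_apply, Matrix.nonsing_inv_mul G hG]
    rw [Finset.sum_eq_single c]
    · simp
    · intro c' _ hc
      simp [hc.symm]
    · simp
  rw [← hsum]
  exact V.sum_mem fun m _ => V.smul_mem _ (hdem _ m)

lemma finrank_listSpan_placed {F : Type u} [Field F] (a : Fin K → F) (τ : Fin K → Fin L) [Decidable (a = 0)] :
    Module.finrank F (listSpan [placed a τ]) = if a = 0 then 0 else 1 := by
  have h1 : listSpan [placed a τ] = Submodule.span F {placed a τ} := by
    simp [listSpan]
  have h2 : placed a τ = 0 ↔ a = 0 := by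
    constructor
    · intro h
      funext k
      simpa [placed] using congrFun (congrFun h k) (τ k)
    · rintro rfl
      funext k r
      simp [placed]
  rw [h1]
  split_ifs with ha
  · rw [h2.2 ha]
    simp
  · exact finrank_span_singleton (h2.not.2 ha)

lemma coefficientLaw_zero (hL : 1 ≤ L) (hreg : HasRegularMatrices F D) {jstar : Fin D}
    {p : PMF (Fin (K - D + 1) × Fin D)}
    (hp : ∀ i j, p (i, j) = ENNReal.ofReal (pairProb K D L jstar i j)) (W : Demand K D) :
    coefficientLaw F L p W 0
      = ENNReal.ofReal (vecF K D L jstar / vecG K D L jstar / (D * L + 1 : ℕ)) := by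
  have h0 : ∀ n, support (0 : Fin n → F) = ∅ := fun n => (support_eq_empty _).2 rfl
  have h1 : ((0 : Fin K → F) ∘ W.coIdx) = 0 := rfl
  have h2 : ((0 : Fin K → F) ∘ W.idx) = 0 := rfl
  rw [coefficientLaw_eq_level hL hreg hp, h1, h2, h0, h0, h0]
  simp [level, sum_backward, vecF_eq]

/-- A query has rank one unless its coefficients all vanish, so each of the `N` servers contributes
one minus the probability of the zero vector. -/
lemma scheme_expectedRank (hL : 1 ≤ L) (hreg : HasRegularMatrices F D) {jstar : Fin D}
    {p : PMF (Fin (K - D + 1) × Fin D)}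
    (hp : ∀ i j, p (i, j) = ENNReal.ofReal (pairProb K D L jstar i j)) (h : D ≤ K) :
    (scheme p : LinearProtocol F K D L (D * L + 1)).expectedRank h
      = ENNReal.ofReal ((D * L + 1 : ℝ) - vecF K D L jstar / vecG K D L jstar) := by
  classical
  obtain ⟨W⟩ := demand_nonempty h
  have hN : (0 : ℝ) < ((D * L + 1 : ℕ) : ℝ) := by exact_mod_cast Nat.succ_pos _
  have hsum : ∀ n, ∑' q, (scheme p : LinearProtocol F K D L (D * L + 1)).queryMarginal h n q
      * (Module.finrank F (listSpan
        ((scheme p : LinearProtocol F K D L (D * L + 1)).coeffs n q)) : ℝ≥0∞)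
      = 1 - coefficientLaw F L p W 0 := by
    intro n
    have hne : NeZero L := ⟨by omega⟩
    rw [← scheme_queryMarginal hL hreg hp h n W, scheme_queryLaw_map hL]
    refine (tsum_bind_mul _ _ _).trans ?_
    refine (tsum_congr fun a => congrArg (coefficientLaw F L p W a * ·) (tsum_map_mul
      (PMF.uniformOfFintype (Fin K → Fin L)) (placed a)
      fun q => (Module.finrank F (listSpan [q]) : ℝ≥0∞))).trans ?_
    simp_rw [finrank_listSpan_placed, ENNReal.tsum_mul_right, PMF.tsum_coe, one_mul]
    have h1 := ENNReal.tsum_eq_add_tsum_ite (f := fun a => coefficientLaw F L p W a) 0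
    rw [PMF.tsum_coe] at h1
    rw [h1, ENNReal.add_sub_cancel_left (PMF.apply_ne_top _ _)]
    refine tsum_congr fun a => ?_
    split_ifs <;> simp
  unfold LinearProtocol.expectedRank
  simp_rw [hsum, coefficientLaw_zero hL hreg hp W]
  rw [Finset.sum_const, Finset.card_univ, Fintype.card_fin, nsmul_eq_mul, ← ENNReal.ofReal_one,
    ← ENNReal.ofReal_sub _ (div_nonneg (ratio_nonneg K D L jstar) hN.le),
    ← ENNReal.ofReal_natCast, ← ENNReal.ofReal_mul hN.le, mul_sub, mul_one,
    mul_div_cancel₀ _ hN.ne']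
  push_cast
  rfl

lemma scheme_rate (hD : 1 ≤ D) (hL : 1 ≤ L) (hreg : HasRegularMatrices F D) {jstar : Fin D}
    {p : PMF (Fin (K - D + 1) × Fin D)}
    (hp : ∀ i j, p (i, j) = ENNReal.ofReal (pairProb K D L jstar i j)) (h : D ≤ K) {s : ℕ}
    (hs : 1 ≤ s)
    (hmax : ∀ j : Fin D, vecF K D L j / vecG K D L j ≤ vecF K D L jstar / vecG K D L jstar) :
    (scheme p : LinearProtocol F K D L (D * L + 1)).rate s h
      = ENNReal.ofReal (lowerBound K D L) := by
  have hsup : ⨆ j : Fin D, vecF K D L j / vecG K D L j = vecF K D L jstar / vecG K D L jstar := by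
    have : Nonempty (Fin D) := ⟨jstar⟩
    exact le_antisymm (ciSup_le hmax) (le_ciSup (f := fun j => vecF K D L j / vecG K D L j)
      (Set.finite_range _).bddAbove jstar)
  have hDL : (D * L : ℝ≥0∞) = ENNReal.ofReal (D * L : ℝ) := by
    rw [ENNReal.ofReal_mul (Nat.cast_nonneg _), ENNReal.ofReal_natCast, ENNReal.ofReal_natCast]
  have hpos : (0 : ℝ) < (D * L + 1 : ℝ) - vecF K D L jstar / vecG K D L jstar := by
    have h1 := ratio_le_one K D L jstar
    have h2 : (0 : ℝ) < D * L := by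
      have : 0 < D * L := Nat.mul_pos hD hL
      exact_mod_cast this
    linarith
  rw [LinearProtocol.rate_eq _ hs, scheme_expectedRank hL hreg hp, lowerBound, hsup, hDL,
    ENNReal.ofReal_div_of_pos hpos]

end Rate

end MPIR

end

theorem theorem1 {F : Type u} [Field F] [Fintype F] (K D L s : ℕ)
    (hD : 1 ≤ D) (hDK : D ≤ K) (hL : 1 ≤ L) (hs : 1 ≤ s) :
    (3 ≤ Fintype.card F →
      ENNReal.ofReal (MPIR.lowerBound K D L) ≤ MPIR.capacity F L (D * L + 1) s hDK ∧
      ∀ jstar : Fin D,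
        (∀ j : Fin D, MPIR.vecF K D L j / MPIR.vecG K D L j
          ≤ MPIR.vecF K D L jstar / MPIR.vecG K D L jstar) →
        ∃ p : PMF (Fin (K - D + 1) × Fin D),
          (∀ i j, p (i, j) = ENNReal.ofReal (MPIR.pairProb K D L jstar i j)) ∧
          (∀ i j, 0 ≤ MPIR.pairProb K D L jstar i j) ∧
          (MPIR.scheme p : MPIR.LinearProtocol F K D L (D * L + 1)).IsPrivate hDK ∧
          (MPIR.scheme p : MPIR.LinearProtocol F K D L (D * L + 1)).IsRecoverable s ∧
          (MPIR.scheme p : MPIR.LinearProtocol F K D L (D * L + 1)).rate s hDK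
            = ENNReal.ofReal (MPIR.lowerBound K D L)) ∧
    MPIR.capacity F L (D * L + 1) s hDK ≤ ENNReal.ofReal (MPIR.upperBound K D (D * L + 1)) := by
  refine ⟨fun hF => ?_, ?_⟩
  · have hreg := MPIR.hasRegularMatrices hF D
    have hlaw : ∀ (jstar : Fin D) i j,
        MPIR.pairLaw K D L jstar (i, j) = ENNReal.ofReal (MPIR.pairProb K D L jstar i j) :=
      fun jstar i j => rfl
    refine ⟨?_, fun jstar hmax => ⟨MPIR.pairLaw K D L jstar, hlaw jstar,
      MPIR.pairProb_nonneg K D L jstar, MPIR.scheme_isPrivate hL hreg (hlaw jstar) hDK,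
      MPIR.scheme_isRecoverable _ hs, MPIR.scheme_rate hD hL hreg (hlaw jstar) hDK hs hmax⟩⟩
    have : Nonempty (Fin D) := ⟨⟨0, hD⟩⟩
    obtain ⟨jstar, hmax⟩ := Finite.exists_max fun j => MPIR.vecF K D L j / MPIR.vecG K D L j
    rw [← MPIR.scheme_rate (F := F) hD hL hreg (hlaw jstar) hDK hs hmax]
    exact le_iSup_of_le _ (le_iSup_of_le (MPIR.scheme_isPrivate hL hreg (hlaw jstar) hDK)
      (le_iSup_of_le (MPIR.scheme_isRecoverable _ hs) le_rfl))
  · exact MPIR.capacity_le_upperBound hD hDK hL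
      (Nat.succ_le_succ (Nat.mul_pos hD hL)) hs
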